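/- Let $d\ge 1$ and let $X_1,X_2,\dots$ be i.i.d. random vectors in $\mathbb{R}^d$ whose law has a density $f$ with respect to the Lebesgue measure. Let $\rho$ be the Euclidean distance, $B(x,r)$ the closed ball of center $x$ and radius $r$, $V_d=\pi^{d/2}/\Gamma(\frac d2+1)$ the volume of the unit ball, $\gamma=-\int_0^\infty e^{-t}\log t\,dt$ the Euler constant, $H=-\int_{\mathbb{R}^d} f(x)\log f(x)\,dx$ (with $0\log 0=0$) the entropy of $f$, and $S(f)=\{x: f(x)>0\}$. For $N\ge 2$ and $1\le i\le N$ put $\rho_i=\min\{\rho(X_i,X_j): 1\le j\le N,\ j\ne i\}$, and let $$H_N = d\log\big((\rho_1\cdots\rho_N)^{1/N}\big)+\log V_d+\gamma+\log(N-1)$$ be the Kozachenko–Leonenko estimate of $H$. Put $G(t)=0$ for $0\le t<1$ and $G(t)=t\log t$ for $t\ge1$; let $$M_f(x,R)=\sup_{0<r\le R}\frac{1}{r^dV_d}\int_{B(x,r)}f(y)\,dy,\qquad m_f(x,R)=\inf_{0<r\le R}\frac{1}{r^dV_d}\int_{B(x,r)}f(y)\,dy,$$ and define, with values in $[0,\infty]$,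 $$K_{f,2}(\varepsilon)=\int\Big(\int G\big(\log^2\rho(x,y)\big)f(y)\,dy\Big)^{1+\varepsilon}f(x)\,dx,$$ $$Q_f(\varepsilon,R)=\int M_f(x,R)^{\varepsilon}f(x)\,dx,\qquad T_f(\varepsilon,R)=\int m_f(x,R)^{-\varepsilon}f(x)\,dx .$$ Consider the conditions - (B): some version of the density $f$ satisfies $f(x)\le M$ for all $x\in\mathbb{R}^d$, with a constant $0<M<\infty$; - (C1): some version of the density $f$ satisfies $f(x)\ge m$ for all $x\in S(f)$, with a constant $m>0$. Assume that 1. $K_{f,2}(\varepsilon_0)<\infty$ for some $\varepsilon_0>0$, or $\mathsf{E}|\log\rho(X_1,X_2)|^p=\iint|\log\rho(x,y)|^p f(x)f(y)\,dx\,dy<\infty$ for some $p>2$; 2. $Q_f(\varepsilon_1,R_1)<\infty$ for some $\varepsilon_1,R_1>0$, or (B) holds; 3. $T_f(\varepsilon_2,R_2)<\infty$ for some $\varepsilon_2,R_2>0$, or (C1) holds. Then $\int f|\log f|\,dx<\infty$, so that $H$ is finite, and the estimates $H_N$ are $L^2$-consistent, i.e. $$\mathsf{E}(H_N-H)^2\to0,\qquad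 N\to\infty .$$ Moreover, the same conclusion holds whenever (B) and (C1) hold and $f$ has a bounded support $S(f)$ (for some version of $f$). -/

import Mathlib

open MeasureTheory ProbabilityTheory Filter Topology
open scoped ENNReal

noncomputable section

namespace KozachenkoLeonenko

/-- The Euclidean space of dimension `d`. -/
abbrev E (d : ℕ) : Type := EuclideanSpace ℝ (Fin d)

/-- `f` is a probability density with respect to the Lebesgue measure.
(`AEMeasurable f volume` is Lebesgue measurability.) -/
def IsProbDensity {d : ℕ} (f : E d → ℝ) : Prop :=
  AEMeasurable f volume ∧ (∀ x, 0 ≤ f x) ∧ ∫⁻ x, ENNReal.ofReal (f x) = 1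

/-- `g` is a version of the density `f`. -/
def IsVersion {d : ℕ} (g f : E d → ℝ) : Prop :=
  IsProbDensity g ∧ g =ᵐ[volume] f

/-- The support `S(f) = {x : f(x) > 0}`. -/
def densitySupport {d : ℕ} (f : E d → ℝ) : Set (E d) := {x | 0 < f x}

/-- The volume of the unit ball of `ℝ^d`. -/
def unitBallVolume (d : ℕ) : ℝ :=
  Real.pi ^ ((d : ℝ) / 2) / Real.Gamma ((d : ℝ) / 2 + 1)

/-- The Euler constant, as `-∫_{(0,∞)} e^{-t} log t dt`. -/
def eulerConstant : ℝ := -∫ t in Set.Ioi (0 : ℝ), Real.exp (-t) * Real.log t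

/-- The differential entropy `H(f) = -∫ f log f` (with `0 log 0 = 0`). -/
def entropy {d : ℕ} (f : E d → ℝ) : ℝ := -∫ x, f x * Real.log (f x)

/-- The integral that defines `H(f)` converges absolutely. -/
def HasFiniteEntropy {d : ℕ} (f : E d → ℝ) : Prop :=
  Integrable (fun x => f x * Real.log (f x)) volume

/-- The distance from the `i`-th point of a sample to its nearest neighbour among the other
points (a minimum over a finite set, non-empty when `2 ≤ N`). -/
def nearestDist {d N : ℕ} (x : Fin N → E d) (i : Fin N) : ℝ :=
  ⨅ j : {j : Fin N // j ≠ i}, dist (x i) (x j)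

/-- The Kozachenko - Leonenko estimate
`H_N = d log (ρ_1 ⋯ ρ_N)^{1/N} + log V_d + γ + log (N - 1)` of the entropy, meant for `2 ≤ N`.
Coinciding sample points, for which the logarithm would be `-∞`, have probability zero. -/
def klEstimate {d N : ℕ} (x : Fin N → E d) : ℝ :=
  d * Real.log ((∏ i, nearestDist x i) ^ (1 / (N : ℝ)))
    + Real.log (unitBallVolume d) + eulerConstant + Real.log ((N : ℝ) - 1)

/-- The function `G`: `0` for `t < 1`, and `t log t` for `t ≥ 1`. -/
def G (t : ℝ) : ℝ := if t < 1 then 0 else t * Real.log t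

/-- `I_f(x,r)`, the mean value of `f` over the closed ball of center `x` and radius `r`. -/
def ballMean {d : ℕ} (f : E d → ℝ) (x : E d) (r : ℝ) : ℝ≥0∞ :=
  (∫⁻ y in Metric.closedBall x r, ENNReal.ofReal (f y)) /
    ENNReal.ofReal (r ^ d * unitBallVolume d)

/-- `M_f(x,R)`. -/
def supMean {d : ℕ} (f : E d → ℝ) (x : E d) (R : ℝ) : ℝ≥0∞ :=
  ⨆ r ∈ Set.Ioc (0 : ℝ) R, ballMean f x r

/-- `m_f(x,R)`. -/
def infMean {d : ℕ} (f : E d → ℝ) (x : E d) (R : ℝ) : ℝ≥0∞ :=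
  ⨅ r ∈ Set.Ioc (0 : ℝ) R, ballMean f x r

/-- `K_{f,2}(ε) = ∫ (∫ G(log² ρ(x,y)) f(y) dy)^{1+ε} f(x) dx`. The diagonal `y = x` is negligible
in the inner integral. -/
def K₂ {d : ℕ} (f : E d → ℝ) (ε : ℝ) : ℝ≥0∞ :=
  ∫⁻ x, (∫⁻ y, ENNReal.ofReal (G (Real.log (dist x y) ^ 2)) * ENNReal.ofReal (f y)) ^ (1 + ε)
    * ENNReal.ofReal (f x)

/-- `Q_f(ε,R) = ∫ M_f(x,R)^ε f(x) dx`. -/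
def Q {d : ℕ} (f : E d → ℝ) (ε R : ℝ) : ℝ≥0∞ :=
  ∫⁻ x, supMean f x R ^ ε * ENNReal.ofReal (f x)

/-- `T_f(ε,R) = ∫ m_f(x,R)^{-ε} f(x) dx`, where `0^{-ε} = ∞`. -/
def T {d : ℕ} (f : E d → ℝ) (ε R : ℝ) : ℝ≥0∞ :=
  ∫⁻ x, infMean f x R ^ (-ε) * ENNReal.ofReal (f x)

/-- `∫∫ |log ρ(x,y)|^p f(x) f(y) dx dy`, that is `E |log ρ(X₁,X₂)|^p`. -/
def logMoment {d : ℕ} (f : E d → ℝ) (p : ℝ) : ℝ≥0∞ :=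
  ∫⁻ x, ∫⁻ y, ENNReal.ofReal (|Real.log (dist x y)| ^ p) *
    ENNReal.ofReal (f x) * ENNReal.ofReal (f y)

/-- Condition (B): some version of the density is bounded. -/
def CondB {d : ℕ} (f : E d → ℝ) : Prop :=
  ∃ g : E d → ℝ, IsVersion g f ∧ ∃ M : ℝ, 0 < M ∧ ∀ x, g x ≤ M

/-- Condition (C1): some version of the density is bounded away from zero on its support. -/
def CondC1 {d : ℕ} (f : E d → ℝ) : Prop :=
  ∃ g : E d → ℝ, IsVersion g f ∧ ∃ m : ℝ, 0 < m ∧ ∀ x ∈ densitySupport g, m ≤ g x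

/-- Some version of the density has a bounded support. -/
def HasBoundedSupport {d : ℕ} (f : E d → ℝ) : Prop :=
  ∃ g : E d → ℝ, IsVersion g f ∧ Bornology.IsBounded (densitySupport g)

/-- `E (H_N - H(f))² → 0` as `N → ∞`, the expectation being taken in `[0,∞]`. -/
def L2Consistent {d : ℕ} {Ω : Type*} [MeasurableSpace Ω] (P : Measure Ω)
    (X : ℕ → Ω → E d) (f : E d → ℝ) : Prop :=
  Tendsto
    (fun N : ℕ => ∫⁻ ω, ENNReal.ofReal
      ((klEstimate (fun i : Fin N => X i ω) - entropy f) ^ 2) ∂P)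
    atTop (𝓝 0)

end KozachenkoLeonenko

end

noncomputable section

namespace KozachenkoLeonenko

/-! ### Nearest neighbour distances in a sample -/

/-! Put Y_i = log((N-1) V_d ρ_i^d) (`logSpacing`). Then H_N is γ plus the mean of the Y_i
(`klEstimate_eq`), so a law of large numbers in L² for the dependent variables Y_i is needed.

Convergence of the empirical distribution. Y_i > s means that the other N-1 points avoid the ball
around X_i of volume e^s/(N-1). By Lebesgue differentiation the probability of this tends to E
exp(-f(X) e^s) (`tendsto_isolProb`). Two such events are asymptotically independent, because the two
balls are disjoint unless the centres are close, which is unlikely (`real_compl_inter_pow_le`).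
Hence the fraction of i with Y_i > s converges in L² for each s. Integrating over s in (-A, A] gives
L² convergence of the means of the Y_i truncated at ±A (`tendsto_integral_clamp_sub_sq`).

Identification of the limit. E exp(-f(X) e^s) is the survival function of log T - log f(X), with T
standard exponential and independent of X. Its expectation is H - γ, which the constant γ in H_N
corrects (`tendsto_clampLimit`).

Removal of the truncation. A tail bound with finite second moment, uniform in N, is required
(`sampleLaw_lt_abs_logSpacing_le`). Small distances cost at most Q e^{-εs}, from 1 - (1-p)^k ≤
(kp)^ε. Large distances are handled by packing: a cell of mass q and diameter at most r contributes
at most q(1-q)^k ≤ 1/k to the isolation probability, whatever its mass, so only the number of cells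
covering a ball of radius l matters, together with the mass outside that ball
(`isolProb_le_packing`). With l a small power of e^s this yields exponential decay plus a tail of
log ‖X‖, and the second logarithmic moment makes that tail summable. -/

lemma measurable_nearestDist {d N : ℕ} (i : Fin N) :
    Measurable fun x : Fin N → E d => nearestDist x i := by
  unfold nearestDist
  exact Measurable.iInf fun j => (measurable_pi_apply i).dist (measurable_pi_apply _)

/-- Sample sizes are written n + 2 so that there is another point: the infimum is then an attained
minimum, whereas a real infimum over an empty family is 0 by convention. -/
lemma lt_nearestDist_iff {d n : ℕ} (x : Fin (n + 2) → E d) (i : Fin (n + 2)) (r : ℝ) :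
    r < nearestDist x i ↔ ∀ k : Fin (n + 1), r < dist (x i) (x (i.succAbove k)) := by
  have hne : Nonempty {j : Fin (n + 2) // j ≠ i} := ⟨⟨i.succAbove 0, Fin.succAbove_ne i 0⟩⟩
  constructor
  · intro h k
    refine h.trans_le ?_
    exact ciInf_le (f := fun j : {j : Fin (n + 2) // j ≠ i} => dist (x i) (x j))
      (Set.finite_range _).bddBelow ⟨i.succAbove k, Fin.succAbove_ne i k⟩
  · intro h
    obtain ⟨⟨j, hj⟩, hjm⟩ := exists_eq_ciInf_of_finite
      (f := fun j : {j : Fin (n + 2) // j ≠ i} => dist (x i) (x j))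
    obtain ⟨k, rfl⟩ := Fin.exists_succAbove_eq hj
    unfold nearestDist
    rw [← hjm]
    exact h k

variable {d : ℕ} (μ : Measure (E d)) [IsProbabilityMeasure μ]

/-- The law of a sample of `N` independent points with law `μ`. -/
abbrev sampleLaw (N : ℕ) : Measure (Fin N → E d) := Measure.pi fun _ => μ

/-- Conditioning on one sample point: the remaining ones are again an independent sample, and Fubini
applies. -/
lemma sampleLaw_fst (n : ℕ) (i : Fin (n + 2)) {T : Set (E d × (Fin (n + 1) → E d))}
    (hT : MeasurableSet T) :
    sampleLaw μ (n + 2) {x | (x i, fun k => x (i.succAbove k)) ∈ T}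
      = ∫⁻ x, sampleLaw μ (n + 1) (Prod.mk x ⁻¹' T) ∂μ := by
  have h := measurePreserving_piFinSuccAbove (fun _ : Fin (n + 2) => μ) i
  rw [← Measure.prod_apply hT, ← h.measure_preimage hT.nullMeasurableSet]
  rfl

lemma measurableSet_forall_lt_dist {n : ℕ} (r : ℝ) :
    MeasurableSet {p : E d × (Fin n → E d) | ∀ k, r < dist p.1 (p.2 k)} := by
  simp only [Set.ofPred_forall]
  refine MeasurableSet.iInter fun k => measurableSet_lt measurable_const ?_
  exact measurable_fst.dist ((measurable_pi_apply k).comp measurable_snd)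

lemma compl_closedBall_eq (x : E d) (r : ℝ) :
    (Metric.closedBall x r)ᶜ = {y | r < dist x y} := by
  ext y
  simp [dist_comm]

lemma sampleLaw_lt_nearestDist (n : ℕ) (i : Fin (n + 2)) (r : ℝ) :
    sampleLaw μ (n + 2) {x | r < nearestDist x i}
      = ∫⁻ x, μ (Metric.closedBall x r)ᶜ ^ (n + 1) ∂μ := by
  have h := sampleLaw_fst μ n i (measurableSet_forall_lt_dist (d := d) (n := n + 1) r)
  simp only [lt_nearestDist_iff]
  refine h.trans (lintegral_congr fun x => ?_)
  have : (Prod.mk x ⁻¹' {p : E d × (Fin (n + 1) → E d) | ∀ k, r < dist p.1 (p.2 k)})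
      = Set.univ.pi fun _ => (Metric.closedBall x r)ᶜ := by
    ext y
    simp only [compl_closedBall_eq, Set.mem_preimage, Set.mem_ofPred_eq, Set.mem_univ_pi]
  rw [this, Measure.pi_pi]
  simp

/-- Both of two sample points are isolated only if all other points avoid both balls. -/
lemma sampleLaw_lt_nearestDist_and_le (n : ℕ) {i j : Fin (n + 2)} (hij : i ≠ j) (r : ℝ) :
    sampleLaw μ (n + 2) {x | r < nearestDist x i ∧ r < nearestDist x j}
      ≤ ∫⁻ x, ∫⁻ y, μ ((Metric.closedBall x r)ᶜ ∩ (Metric.closedBall y r)ᶜ) ^ n ∂μ ∂μ := by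
  obtain ⟨k, rfl⟩ := Fin.exists_succAbove_eq hij.symm
  -- Only the n remaining points are constrained; the condition on the mutual distance of the two
  -- chosen points is dropped, hence an inequality.
  set T : Set (E d × (Fin (n + 1) → E d)) :=
    {p | ∀ l, r < dist p.1 (p.2 (k.succAbove l)) ∧ r < dist (p.2 k) (p.2 (k.succAbove l))} with hTdef
  have hT : MeasurableSet T := by
    simp only [hTdef, Set.ofPred_forall, Set.ofPred_and]
    exact MeasurableSet.iInter fun l => (measurableSet_lt (by fun_prop) (by fun_prop)).inter
      (measurableSet_lt (by fun_prop) (by fun_prop))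
  calc sampleLaw μ (n + 2) {x | r < nearestDist x i ∧ r < nearestDist x (i.succAbove k)}
      ≤ sampleLaw μ (n + 2) {x | (x i, fun k => x (i.succAbove k)) ∈ T} := by
        refine measure_mono fun x hx l => ⟨(lt_nearestDist_iff x i r).1 hx.1 _, ?_⟩
        refine hx.2.trans_le ?_
        refine ciInf_le (f := fun j : {j // j ≠ i.succAbove k} => dist (x (i.succAbove k)) (x j))
          (Set.finite_range _).bddBelow ⟨i.succAbove (k.succAbove l), ?_⟩
        exact fun h => Fin.succAbove_ne k l (Fin.succAbove_right_injective h)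
    _ = ∫⁻ x, sampleLaw μ (n + 1) (Prod.mk x ⁻¹' T) ∂μ := sampleLaw_fst μ n i hT
    _ = _ := by
        refine lintegral_congr fun x => ?_
        have h := measurePreserving_piFinSuccAbove (fun _ : Fin (n + 1) => μ) k
        set U : Set (E d × (Fin n → E d)) := {p | ∀ l, r < dist x (p.2 l) ∧ r < dist p.1 (p.2 l)}
          with hU
        have hUm : MeasurableSet U := by
          simp only [hU, Set.ofPred_forall, Set.ofPred_and]
          exact MeasurableSet.iInter fun l => (measurableSet_lt (by fun_prop) (by fun_prop)).inter
            (measurableSet_lt (by fun_prop) (by fun_prop))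
        have h1 : sampleLaw μ (n + 1) (Prod.mk x ⁻¹' T)
            = (μ.prod (sampleLaw μ n)) U := by
          rw [← h.measure_preimage hUm.nullMeasurableSet]
          rfl
        rw [h1, Measure.prod_apply hUm]
        refine lintegral_congr fun y => ?_
        have : Prod.mk y ⁻¹' U = Set.univ.pi fun _ =>
            (Metric.closedBall x r)ᶜ ∩ (Metric.closedBall y r)ᶜ := by
          ext z
          simp only [hU, compl_closedBall_eq, Set.mem_preimage, Set.mem_ofPred_eq, Set.mem_univ_pi,
            Set.mem_inter_iff]
        rw [this, Measure.pi_pi]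
        simp

lemma measurable_measure_closedBall (r : ℝ) :
    Measurable fun x : E d => μ (Metric.closedBall x r) := by
  have h : MeasurableSet {p : E d × E d | dist p.1 p.2 ≤ r} :=
    measurableSet_le (measurable_fst.dist measurable_snd) measurable_const
  have h2 : (fun x : E d => μ (Metric.closedBall x r))
      = fun x => μ (Prod.mk x ⁻¹' {p : E d × E d | dist p.1 p.2 ≤ r}) := by
    funext x
    congr 1
    ext y
    simp [dist_comm]
  rw [h2]
  exact measurable_measure_prodMk_left h

/-- The probability that two independent points are within distance `r`. -/
def closeProb (r : ℝ) : ℝ := ∫ x, μ.real (Metric.closedBall x r) ∂μ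

/-- The probability that a point has no neighbour within distance `r` among `k` others. -/
def isolProb (k : ℕ) (r : ℝ) : ℝ := ∫ x, (1 - μ.real (Metric.closedBall x r)) ^ k ∂μ

lemma measurable_real_closedBall (r : ℝ) :
    Measurable fun x : E d => μ.real (Metric.closedBall x r) :=
  (measurable_measure_closedBall μ r).ennreal_toReal

lemma integrable_real_closedBall (r : ℝ) :
    Integrable (fun x : E d => μ.real (Metric.closedBall x r)) μ :=
  Integrable.of_bound (measurable_real_closedBall μ r).aestronglyMeasurable 1
    (ae_of_all _ fun x => by
      rw [Real.norm_of_nonneg measureReal_nonneg]; exact measureReal_le_one)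

lemma integrable_isol (k : ℕ) (r : ℝ) :
    Integrable (fun x : E d => (1 - μ.real (Metric.closedBall x r)) ^ k) μ :=
  Integrable.of_bound
    ((measurable_const.sub (measurable_real_closedBall μ r)).pow_const k).aestronglyMeasurable 1
    (ae_of_all _ fun x => by
      have h0 : 0 ≤ 1 - μ.real (Metric.closedBall x r) := sub_nonneg.2 measureReal_le_one
      rw [Real.norm_of_nonneg (pow_nonneg h0 k)]
      exact pow_le_one₀ h0 (by linarith [measureReal_nonneg (μ := μ) (s := Metric.closedBall x r)]))

lemma sampleLaw_real_lt_nearestDist (n : ℕ) (i : Fin (n + 2)) (r : ℝ) :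
    (sampleLaw μ (n + 2)).real {x | r < nearestDist x i} = isolProb μ (n + 1) r := by
  rw [measureReal_def, sampleLaw_lt_nearestDist, isolProb, integral_eq_lintegral_of_nonneg_ae]
  · congr 1
    refine lintegral_congr fun x => ?_
    have h0 : 0 ≤ 1 - μ.real (Metric.closedBall x r) := sub_nonneg.2 measureReal_le_one
    rw [ENNReal.ofReal_pow h0, ← probReal_compl_eq_one_sub Metric.isClosed_closedBall.measurableSet,
      measureReal_def, ENNReal.ofReal_toReal (measure_ne_top _ _)]
  · exact ae_of_all _ fun x => pow_nonneg (sub_nonneg.2 measureReal_le_one) _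
  · exact (integrable_isol μ _ _).aestronglyMeasurable

lemma isolProb_nonneg (k : ℕ) (r : ℝ) : 0 ≤ isolProb μ k r :=
  integral_nonneg fun _ => pow_nonneg (sub_nonneg.2 measureReal_le_one) _

lemma closeProb_nonneg {d : ℕ} (ν : Measure (E d)) (r : ℝ) : 0 ≤ closeProb ν r :=
  integral_nonneg fun _ => measureReal_nonneg

lemma closeProb_mono {r s : ℝ} (h : r ≤ s) : closeProb μ r ≤ closeProb μ s :=
  integral_mono (integrable_real_closedBall μ r) (integrable_real_closedBall μ s) fun _ =>
    measureReal_mono (Metric.closedBall_subset_closedBall h)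

/-- The difference (1-p)^k - (1-p)^(k+1) = p(1-p)^k is at most p. This reconciles the n points left
over by a pair with the n + 1 left over by a single point. -/
lemma isolProb_le_succ_add (k : ℕ) (r : ℝ) :
    isolProb μ k r ≤ isolProb μ (k + 1) r + closeProb μ r := by
  rw [isolProb, isolProb, closeProb,
    ← integral_add (integrable_isol μ _ _) (integrable_real_closedBall μ r)]
  refine integral_mono (integrable_isol μ _ _)
    ((integrable_isol μ _ _).add (integrable_real_closedBall μ r)) fun x => ?_
  have h0 : 0 ≤ 1 - μ.real (Metric.closedBall x r) := sub_nonneg.2 measureReal_le_one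
  have hp := measureReal_nonneg (μ := μ) (s := Metric.closedBall x r)
  have h1 : (1 - μ.real (Metric.closedBall x r)) ^ k ≤ 1 := pow_le_one₀ h0 (by linarith)
  simp only [pow_succ]
  nlinarith

/-- If the centres are more than 2r apart, the balls are disjoint and 1 - p - q ≤ (1-p)(1-q).
Otherwise the indicator pays for the trivial bound 1. -/
lemma real_compl_inter_pow_le (n : ℕ) (r : ℝ) (x y : E d) :
    μ.real ((Metric.closedBall x r)ᶜ ∩ (Metric.closedBall y r)ᶜ) ^ n
      ≤ (1 - μ.real (Metric.closedBall x r)) ^ n * (1 - μ.real (Metric.closedBall y r)) ^ n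
        + (Metric.closedBall x (2 * r)).indicator (fun _ => (1 : ℝ)) y := by
  have hx0 : 0 ≤ 1 - μ.real (Metric.closedBall x r) := sub_nonneg.2 measureReal_le_one
  have hy0 : 0 ≤ 1 - μ.real (Metric.closedBall y r) := sub_nonneg.2 measureReal_le_one
  by_cases h : y ∈ Metric.closedBall x (2 * r)
  · rw [Set.indicator_of_mem h]
    have : μ.real ((Metric.closedBall x r)ᶜ ∩ (Metric.closedBall y r)ᶜ) ^ n ≤ 1 :=
      pow_le_one₀ measureReal_nonneg measureReal_le_one
    have := mul_nonneg (pow_nonneg hx0 n) (pow_nonneg hy0 n)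
    linarith
  · rw [Set.indicator_of_notMem h, add_zero, ← mul_pow]
    refine pow_le_pow_left₀ measureReal_nonneg ?_ n
    have hd : Disjoint (Metric.closedBall x r) (Metric.closedBall y r) := by
      refine Metric.closedBall_disjoint_closedBall ?_
      rw [Metric.mem_closedBall, dist_comm] at h
      linarith
    rw [← Set.compl_union, probReal_compl_eq_one_sub
      (Metric.isClosed_closedBall.measurableSet.union Metric.isClosed_closedBall.measurableSet),
      measureReal_union hd Metric.isClosed_closedBall.measurableSet]
    nlinarith [measureReal_nonneg (μ := μ) (s := Metric.closedBall x r),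
      measureReal_nonneg (μ := μ) (s := Metric.closedBall y r)]

lemma sampleLaw_real_lt_nearestDist_and_le (n : ℕ) {i j : Fin (n + 2)} (hij : i ≠ j) (r : ℝ) :
    (sampleLaw μ (n + 2)).real {x | r < nearestDist x i ∧ r < nearestDist x j}
      ≤ isolProb μ n r ^ 2 + closeProb μ (2 * r) := by
  have hnn : ∀ x : E d, 0 ≤ (1 - μ.real (Metric.closedBall x r)) ^ n := fun x =>
    pow_nonneg (sub_nonneg.2 measureReal_le_one) n
  refine ENNReal.toReal_le_of_le_ofReal
    (add_nonneg (sq_nonneg _) (closeProb_nonneg μ _)) ?_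
  refine (sampleLaw_lt_nearestDist_and_le μ n hij r).trans ?_
  calc ∫⁻ x, ∫⁻ y, μ ((Metric.closedBall x r)ᶜ ∩ (Metric.closedBall y r)ᶜ) ^ n ∂μ ∂μ
      ≤ ∫⁻ x, ENNReal.ofReal ((1 - μ.real (Metric.closedBall x r)) ^ n * isolProb μ n r
          + μ.real (Metric.closedBall x (2 * r))) ∂μ := by
        refine lintegral_mono fun x => ?_
        have hind : Integrable ((Metric.closedBall x (2 * r)).indicator fun _ => (1 : ℝ)) μ :=
          (integrable_const _).indicator Metric.isClosed_closedBall.measurableSet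
        have hval : (1 - μ.real (Metric.closedBall x r)) ^ n * isolProb μ n r
            + μ.real (Metric.closedBall x (2 * r))
            = ∫ y, ((1 - μ.real (Metric.closedBall x r)) ^ n
                * (1 - μ.real (Metric.closedBall y r)) ^ n
              + (Metric.closedBall x (2 * r)).indicator (fun _ => (1 : ℝ)) y) ∂μ := by
          rw [integral_add ((integrable_isol μ n r).const_mul _) hind, integral_const_mul,
            integral_indicator_const _ Metric.isClosed_closedBall.measurableSet]
          simp [isolProb]
        rw [hval, ofReal_integral_eq_lintegral_ofReal
          (by exact ((integrable_isol μ n r).const_mul _).add hind)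
          (ae_of_all _ fun y => add_nonneg (mul_nonneg (hnn x) (hnn y))
            (Set.indicator_nonneg (fun _ _ => zero_le_one) y))]
        refine lintegral_mono fun y => ?_
        rw [← ENNReal.ofReal_toReal (measure_ne_top μ
          ((Metric.closedBall x r)ᶜ ∩ (Metric.closedBall y r)ᶜ)), ← ENNReal.ofReal_pow
          ENNReal.toReal_nonneg]
        exact ENNReal.ofReal_le_ofReal (real_compl_inter_pow_le μ n r x y)
    _ = _ := by
        rw [← ofReal_integral_eq_lintegral_ofReal
          (by exact ((integrable_isol μ n r).mul_const _).add (integrable_real_closedBall μ _))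
          (ae_of_all _ fun y => add_nonneg (mul_nonneg (hnn y) (isolProb_nonneg μ _ _))
            measureReal_nonneg),
          integral_add ((integrable_isol μ n r).mul_const _) (integrable_real_closedBall μ _),
          integral_mul_const, sq]
        rfl

/-- The fraction of the sample points without a neighbour within distance `r`. -/
def isolFrac {N : ℕ} (r : ℝ) (x : Fin N → E d) : ℝ :=
  (∑ i, {x : Fin N → E d | r < nearestDist x i}.indicator (fun _ => (1 : ℝ)) x) / N

lemma measurableSet_lt_nearestDist {N : ℕ} (i : Fin N) (r : ℝ) :
    MeasurableSet {x : Fin N → E d | r < nearestDist x i} :=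
  measurableSet_lt measurable_const (measurable_nearestDist i)

lemma isolFrac_nonneg {N : ℕ} (r : ℝ) (x : Fin N → E d) : 0 ≤ isolFrac r x :=
  div_nonneg (Finset.sum_nonneg fun _ _ => Set.indicator_nonneg (fun _ _ => zero_le_one) _)
    (Nat.cast_nonneg _)

lemma isolFrac_le_one {N : ℕ} (r : ℝ) (x : Fin N → E d) : isolFrac r x ≤ 1 := by
  refine div_le_one_of_le₀ ?_ (Nat.cast_nonneg _)
  calc _ ≤ ∑ _i : Fin N, (1 : ℝ) := Finset.sum_le_sum fun i _ =>
        Set.indicator_le_self' (fun _ _ => zero_le_one) x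
    _ = N := by simp

lemma measurable_isolFrac {N : ℕ} (r : ℝ) : Measurable (isolFrac r : (Fin N → E d) → ℝ) :=
  (Finset.measurable_fun_sum _ fun i _ =>
    measurable_const.indicator (measurableSet_lt_nearestDist i r)).div_const _

/-- The second moment is a double sum over pairs: the diagonal accounts for 1/(n+2), the other pairs
are nearly independent. With c the limit of the isolation probabilities and `closeProb` vanishing,
the bound tends to c² - 2c² + c² = 0. -/
lemma integral_isolFrac_sub_sq_le (n : ℕ) {r : ℝ} (hr : 0 ≤ r) (c : ℝ) :
    ∫ x, (isolFrac r x - c) ^ 2 ∂(sampleLaw μ (n + 2))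
      ≤ 1 / (n + 2 : ℝ) + ((isolProb μ (n + 1) r + closeProb μ (2 * r)) ^ 2 + closeProb μ (2 * r))
        - 2 * c * isolProb μ (n + 1) r + c ^ 2 := by
  set π := sampleLaw μ (n + 2)
  have hint : Integrable (isolFrac r : (Fin (n + 2) → E d) → ℝ) π :=
    Integrable.of_bound (measurable_isolFrac r).aestronglyMeasurable 1
      (ae_of_all _ fun x => by
        rw [Real.norm_of_nonneg (isolFrac_nonneg r x)]; exact isolFrac_le_one r x)
  have hint2 : Integrable (fun x : Fin (n + 2) → E d => isolFrac r x ^ 2) π :=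
    Integrable.of_bound ((measurable_isolFrac r).pow_const 2).aestronglyMeasurable 1
      (ae_of_all _ fun x => by
        rw [Real.norm_of_nonneg (sq_nonneg _)]
        exact pow_le_one₀ (isolFrac_nonneg r x) (isolFrac_le_one r x))
  have hA : ∀ i, MeasurableSet {x : Fin (n + 2) → E d | r < nearestDist x i} := fun i =>
    measurableSet_lt_nearestDist i r
  have hmean : ∫ x, isolFrac r x ∂π = isolProb μ (n + 1) r := by
    simp only [isolFrac]
    rw [integral_div, integral_finsetSum _ fun i _ => (integrable_const _).indicator (hA i)]
    simp_rw [integral_indicator_const _ (hA _)]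
    simp only [π, sampleLaw_real_lt_nearestDist]
    simp
    field_simp
  set β := (isolProb μ (n + 1) r + closeProb μ (2 * r)) ^ 2 + closeProb μ (2 * r) with hβ
  have hβ0 : 0 ≤ β := add_nonneg (sq_nonneg _) (closeProb_nonneg _ _)
  have hpair : ∀ i j : Fin (n + 2),
      π.real {x | r < nearestDist x i ∧ r < nearestDist x j} ≤ (if i = j then 1 else 0) + β := by
    intro i j
    split_ifs with h
    · exact measureReal_le_one.trans (by linarith)
    · rw [zero_add]
      refine (sampleLaw_real_lt_nearestDist_and_le μ n h r).trans ?_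
      have h1 := isolProb_le_succ_add μ n r
      have h2 := closeProb_mono μ (show r ≤ 2 * r by linarith)
      have h3 := isolProb_nonneg μ n r
      have := pow_le_pow_left₀ h3 (h1.trans (by linarith :
        _ ≤ isolProb μ (n + 1) r + closeProb μ (2 * r))) 2
      linarith
  have hsq : ∫ x, isolFrac r x ^ 2 ∂π ≤ 1 / (n + 2 : ℝ) + β := by
    have hexp : ∀ x : Fin (n + 2) → E d, isolFrac r x ^ 2
        = (∑ i, ∑ j, {x : Fin (n + 2) → E d | r < nearestDist x i ∧ r < nearestDist x j}.indicator
            (fun _ => (1 : ℝ)) x) / ((n + 2 : ℕ) : ℝ) ^ 2 := by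
      intro x
      rw [isolFrac, div_pow, sq (Finset.sum _ _), Finset.sum_mul_sum]
      congr 1
      refine Finset.sum_congr rfl fun i _ => Finset.sum_congr rfl fun j _ => ?_
      by_cases h1 : r < nearestDist x i <;> by_cases h2 : r < nearestDist x j <;>
        simp [Set.indicator, h1, h2]
    have hAB : ∀ i j, MeasurableSet
        {x : Fin (n + 2) → E d | r < nearestDist x i ∧ r < nearestDist x j} := fun i j =>
      (hA i).inter (hA j)
    simp_rw [hexp]
    rw [integral_div, integral_finsetSum _ fun i _ => integrable_finsetSum _ fun j _ =>
      (integrable_const _).indicator (hAB i j)]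
    simp_rw [integral_finsetSum _ fun j _ => (integrable_const (1 : ℝ)).indicator (hAB _ j),
      integral_indicator_const _ (hAB _ _)]
    rw [div_le_iff₀ (by positivity)]
    calc ∑ i, ∑ j, π.real {x | r < nearestDist x i ∧ r < nearestDist x j} • (1 : ℝ)
        ≤ ∑ i : Fin (n + 2), ∑ j : Fin (n + 2), ((if i = j then 1 else 0) + β) := by
          simp only [smul_eq_mul, mul_one]
          exact Finset.sum_le_sum fun i _ => Finset.sum_le_sum fun j _ => hpair i j
      _ = (1 / (n + 2 : ℝ) + β) * ((n + 2 : ℕ) : ℝ) ^ 2 := by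
          simp [Finset.sum_add_distrib]
          field_simp
  calc ∫ x, (isolFrac r x - c) ^ 2 ∂π
      = ∫ x, (isolFrac r x ^ 2 - 2 * c * isolFrac r x + c ^ 2) ∂π := by
        congr 1; funext x; ring
    _ = ∫ x, isolFrac r x ^ 2 ∂π - 2 * c * ∫ x, isolFrac r x ∂π + c ^ 2 := by
        rw [integral_add (by exact hint2.sub (hint.const_mul _)) (integrable_const _),
          integral_sub hint2 (hint.const_mul _), integral_const_mul]
        simp
    _ ≤ _ := by rw [hmean]; linarith

end KozachenkoLeonenko

end

noncomputable section

namespace KozachenkoLeonenko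

/-! ### Small balls and the limit of the isolation probabilities -/

lemma unitBallVolume_pos (d : ℕ) : 0 < unitBallVolume d :=
  div_pos (Real.rpow_pos_of_pos Real.pi_pos _) (Real.Gamma_pos_of_pos (by positivity))

lemma volume_closedBall_eq {d : ℕ} (hd : 0 < d) (x : E d) {r : ℝ} (hr : 0 ≤ r) :
    volume (Metric.closedBall x r) = ENNReal.ofReal (r ^ d * unitBallVolume d) := by
  have : Nonempty (Fin d) := ⟨⟨0, hd⟩⟩
  rw [EuclideanSpace.volume_closedBall, Fintype.card_fin, ENNReal.ofReal_mul (pow_nonneg hr d),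
    ENNReal.ofReal_pow hr, unitBallVolume, Real.sqrt_eq_rpow, ← Real.rpow_mul_natCast Real.pi_pos.le]
  congr 4
  ring

/-- The radius `r` of the balls with `k V_d r^d = e^s`. -/
def radius (d k : ℕ) (s : ℝ) : ℝ := Real.exp ((s - Real.log k - Real.log (unitBallVolume d)) / d)

lemma radius_pos (d k : ℕ) (s : ℝ) : 0 < radius d k s := Real.exp_pos _

lemma measurable_radius (d k : ℕ) : Measurable (radius d k) := by
  unfold radius
  fun_prop

lemma radius_pow_mul {d k : ℕ} (hd : 0 < d) (hk : 0 < k) (s : ℝ) :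
    k * (radius d k s ^ d * unitBallVolume d) = Real.exp s := by
  have hd' : (d : ℝ) ≠ 0 := by positivity
  have hk' : (0 : ℝ) < k := by exact_mod_cast hk
  rw [radius, ← Real.exp_nat_mul, mul_div_cancel₀ _ hd', Real.exp_sub, Real.exp_sub,
    Real.exp_log hk', Real.exp_log (unitBallVolume_pos d)]
  have := (unitBallVolume_pos d).ne'
  field_simp

lemma tendsto_radius {d : ℕ} (hd : 0 < d) (s : ℝ) :
    Tendsto (fun k : ℕ => radius d k s) atTop (𝓝[>] 0) := by
  refine tendsto_nhdsWithin_iff.2 ⟨?_, Eventually.of_forall fun k => radius_pos d k s⟩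
  refine Real.tendsto_exp_atBot.comp ?_
  have hd' : (0 : ℝ) < d := by exact_mod_cast hd
  refine Tendsto.atBot_div_const hd' ?_
  refine tendsto_atBot_add_const_right _ _ ?_
  refine tendsto_atBot_add_const_left _ _ ?_
  exact tendsto_neg_atTop_atBot.comp (Real.tendsto_log_atTop.comp tendsto_natCast_atTop_atTop)

variable {d : ℕ} {f : E d → ℝ}

/-- The probability measure with density `f`. -/
def law (f : E d → ℝ) : Measure (E d) := volume.withDensity fun x => ENNReal.ofReal (f x)

lemma IsProbDensity.aemeasurable_ofReal (hf : IsProbDensity f) :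
    AEMeasurable (fun x => ENNReal.ofReal (f x)) volume := hf.1.ennreal_ofReal

lemma IsProbDensity.isProbabilityMeasure_law (hf : IsProbDensity f) :
    IsProbabilityMeasure (law f) :=
  ⟨by rw [law, withDensity_apply _ MeasurableSet.univ, Measure.restrict_univ, hf.2.2]⟩

lemma law_absolutelyContinuous (f : E d → ℝ) : law f ≪ volume :=
  withDensity_absolutelyContinuous _ _

lemma IsProbDensity.lintegral_law (hf : IsProbDensity f) (g : E d → ℝ≥0∞) :
    ∫⁻ x, g x ∂law f = ∫⁻ x, g x * ENNReal.ofReal (f x) := by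
  rw [law, lintegral_withDensity_eq_lintegral_mul_non_measurable₀ _ hf.aemeasurable_ofReal
    (ae_of_all _ fun x => ENNReal.ofReal_lt_top)]
  exact lintegral_congr fun x => mul_comm _ _

lemma law_closedBall (f : E d → ℝ) (x : E d) (r : ℝ) :
    law f (Metric.closedBall x r) = ∫⁻ y in Metric.closedBall x r, ENNReal.ofReal (f y) :=
  withDensity_apply _ Metric.isClosed_closedBall.measurableSet

lemma IsProbDensity.ae_pos_law (hf : IsProbDensity f) : ∀ᵐ x ∂law f, 0 < f x := by
  rw [law, ae_withDensity_iff' hf.aemeasurable_ofReal]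
  refine ae_of_all _ fun x hx => ?_
  by_contra h
  exact hx (ENNReal.ofReal_eq_zero.2 (not_lt.1 h))

lemma IsProbDensity.aemeasurable_law (hf : IsProbDensity f) : AEMeasurable f (law f) :=
  hf.1.mono_ac (law_absolutelyContinuous f)

/-- Lebesgue differentiation for the mean values of the density over closed balls. -/
lemma IsProbDensity.ae_tendsto_ballMean (hd : 0 < d) (hf : IsProbDensity f) :
    ∀ᵐ x : E d, Tendsto (fun r => ballMean f x r) (𝓝[>] 0) (𝓝 (ENNReal.ofReal (f x))) := by
  have := hf.isProbabilityMeasure_law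
  filter_upwards [Besicovitch.ae_tendsto_rnDeriv (law f) volume,
    Measure.rnDeriv_withDensity₀ volume hf.aemeasurable_ofReal] with x hx hx2
  rw [← law] at hx2
  rw [hx2] at hx
  refine hx.congr' ?_
  filter_upwards [self_mem_nhdsWithin] with r hr
  rw [ballMean, law_closedBall, volume_closedBall_eq hd x (le_of_lt hr)]

lemma law_closedBall_eq_ballMean (f : E d → ℝ) (x : E d)
    {r : ℝ} (hr : 0 < r) :
    law f (Metric.closedBall x r) = ballMean f x r * ENNReal.ofReal (r ^ d * unitBallVolume d) := by
  rw [ballMean, ENNReal.div_mul_cancel, law_closedBall]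
  · exact (ENNReal.ofReal_pos.2 (mul_pos (pow_pos hr d) (unitBallVolume_pos d))).ne'
  · exact ENNReal.ofReal_ne_top

lemma law_real_closedBall_eq (f : E d → ℝ) (x : E d)
    {r : ℝ} (hr : 0 < r) :
    (law f).real (Metric.closedBall x r)
      = (ballMean f x r).toReal * (r ^ d * unitBallVolume d) := by
  rw [measureReal_def, law_closedBall_eq_ballMean f x hr, ENNReal.toReal_mul,
    ENNReal.toReal_ofReal (mul_pos (pow_pos hr d) (unitBallVolume_pos d)).le]

lemma IsProbDensity.ae_tendsto_toReal_ballMean (hd : 0 < d) (hf : IsProbDensity f) :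
    ∀ᵐ x ∂law f, Tendsto (fun r => (ballMean f x r).toReal) (𝓝[>] 0) (𝓝 (f x)) := by
  filter_upwards [(law_absolutelyContinuous f).ae_le (hf.ae_tendsto_ballMean hd)] with x hx
  have := (ENNReal.tendsto_toReal ENNReal.ofReal_ne_top).comp hx
  rwa [ENNReal.toReal_ofReal (hf.2.1 x)] at this

/-- The limit of the probability that the rescaled nearest neighbour distance exceeds `s`. -/
def isolLimit (f : E d → ℝ) (s : ℝ) : ℝ := ∫ x, Real.exp (-(f x * Real.exp s)) ∂law f

/-- At a Lebesgue point, k times the mass of the ball is its mean density times e^s, which tends to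
f(x) e^s. So (1 - p)^k has the Poisson limit exp(-f(x) e^s), and everything is dominated by 1. -/
lemma IsProbDensity.tendsto_isolProb (hd : 0 < d) (hf : IsProbDensity f) (s : ℝ) :
    Tendsto (fun k => isolProb (law f) k (radius d k s)) atTop (𝓝 (isolLimit f s)) := by
  have := hf.isProbabilityMeasure_law
  refine tendsto_integral_of_dominated_convergence (fun _ => 1)
    (fun k => (integrable_isol _ _ _).aestronglyMeasurable) (integrable_const _) ?_ ?_
  · refine fun k => ae_of_all _ fun x => ?_
    have h0 : 0 ≤ 1 - (law f).real (Metric.closedBall x (radius d k s)) :=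
      sub_nonneg.2 measureReal_le_one
    rw [Real.norm_of_nonneg (pow_nonneg h0 k)]
    exact pow_le_one₀ h0 (sub_le_self _ measureReal_nonneg)
  · filter_upwards [hf.ae_tendsto_toReal_ballMean hd] with x hx
    simp_rw [sub_eq_add_neg]
    refine Real.tendsto_one_add_pow_exp_of_tendsto ?_
    refine ((hx.comp (tendsto_radius hd s)).mul_const (Real.exp s)).neg.congr' ?_
    filter_upwards [eventually_gt_atTop 0] with k hk
    rw [law_real_closedBall_eq f x (radius_pos d k s), ← radius_pow_mul hd hk s]
    simp only [Function.comp]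
    ring

lemma IsProbDensity.tendsto_closeProb (hd : 0 < d) (hf : IsProbDensity f) :
    Tendsto (closeProb (law f)) (𝓝[>] 0) (𝓝 0) := by
  have := hf.isProbabilityMeasure_law
  have h : Tendsto (closeProb (law f)) (𝓝[>] 0) (𝓝 (∫ _x, (0 : ℝ) ∂law f)) := by
    refine tendsto_integral_filter_of_dominated_convergence (fun _ => 1)
      (Eventually.of_forall fun r => (integrable_real_closedBall _ r).aestronglyMeasurable)
      ?_ (integrable_const _) ?_
    · refine Eventually.of_forall fun r => ae_of_all _ fun x => ?_
      rw [Real.norm_of_nonneg measureReal_nonneg]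
      exact measureReal_le_one
    · filter_upwards [hf.ae_tendsto_toReal_ballMean hd] with x hx
      have h1 : Tendsto (fun r : ℝ => r ^ d * unitBallVolume d) (𝓝[>] 0) (𝓝 0) := by
        have : Continuous fun r : ℝ => r ^ d * unitBallVolume d := by fun_prop
        have h2 := this.tendsto 0
        rw [zero_pow hd.ne', zero_mul] at h2
        exact h2.mono_left nhdsWithin_le_nhds
      have h2 := hx.mul h1
      rw [mul_zero] at h2
      refine h2.congr' ?_
      filter_upwards [self_mem_nhdsWithin] with r hr
      rw [law_real_closedBall_eq f x hr]
  simpa using h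

lemma isolLimit_nonneg (f : E d → ℝ) (s : ℝ) : 0 ≤ isolLimit f s :=
  integral_nonneg fun _ => (Real.exp_pos _).le

lemma IsProbDensity.isolLimit_le_one (hf : IsProbDensity f) (s : ℝ) : isolLimit f s ≤ 1 := by
  have := hf.isProbabilityMeasure_law
  have h : isolLimit f s ≤ ∫ _x, (1 : ℝ) ∂law f := by
    refine integral_mono_of_nonneg (ae_of_all _ fun _ => (Real.exp_pos _).le)
      (integrable_const _) (ae_of_all _ fun x => ?_)
    exact Real.exp_le_one_iff.2 (neg_nonpos.2 (mul_nonneg (hf.2.1 x) (Real.exp_pos s).le))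
  simpa using h

lemma IsProbDensity.measurable_isolLimit (hf : IsProbDensity f) : Measurable (isolLimit f) := by
  have := hf.isProbabilityMeasure_law
  -- The density is only a.e. measurable; a Borel version makes the integrand jointly measurable in
  -- s and x.
  set g := hf.aemeasurable_law.mk f
  have hg : Measurable g := hf.aemeasurable_law.measurable_mk
  have h : isolLimit f = fun s => ∫ x, Real.exp (-(g x * Real.exp s)) ∂law f := by
    funext s
    refine integral_congr_ae ?_
    filter_upwards [hf.aemeasurable_law.ae_eq_mk] with x hx
    rw [hx]
  rw [h]
  have hm : StronglyMeasurable (Function.uncurry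
      fun (s : ℝ) (x : E d) => Real.exp (-(g x * Real.exp s))) := by
    apply Measurable.stronglyMeasurable
    unfold Function.uncurry
    fun_prop
  exact hm.integral_prod_right.measurable

/-- The empirical distribution function of the rescaled nearest neighbour distances converges
in mean square. -/
lemma IsProbDensity.tendsto_integral_isolFrac_sub_sq (hd : 0 < d) (hf : IsProbDensity f) (s : ℝ) :
    Tendsto (fun n : ℕ => ∫ x, (isolFrac (radius d (n + 1) s) x - isolLimit f s) ^ 2
      ∂sampleLaw (law f) (n + 2)) atTop (𝓝 0) := by
  have := hf.isProbabilityMeasure_law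
  set c := isolLimit f s with hc
  have h1 : Tendsto (fun n : ℕ => 1 / ((n : ℝ) + 2)) atTop (𝓝 0) := by
    have := (tendsto_one_div_add_atTop_nhds_zero_nat (𝕜 := ℝ)).comp (tendsto_add_atTop_nat 1)
    refine this.congr fun n => ?_
    simp only [Function.comp]
    push_cast
    ring
  have h2 := (hf.tendsto_isolProb hd s).comp (tendsto_add_atTop_nat 1)
  have h3 : Tendsto (fun n : ℕ => closeProb (law f) (2 * radius d (n + 1) s)) atTop (𝓝 0) := by
    refine (hf.tendsto_closeProb hd).comp ?_
    have h4 := (tendsto_radius hd s).comp (tendsto_add_atTop_nat 1)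
    refine tendsto_nhdsWithin_iff.2 ⟨?_, Eventually.of_forall fun n =>
      mul_pos two_pos (radius_pos d _ s)⟩
    simpa using (h4.mono_right nhdsWithin_le_nhds).const_mul 2
  have h5 := ((h1.add (((h2.add h3).pow 2).add h3)).sub (h2.const_mul (2 * c))).add_const (c ^ 2)
  have h6 : (0 : ℝ) + ((c + 0) ^ 2 + 0) - 2 * c * c + c ^ 2 = 0 := by ring
  rw [← hc, h6] at h5
  exact squeeze_zero (fun n => integral_nonneg fun x => sq_nonneg _)
    (fun n => integral_isolFrac_sub_sq_le (law f) n (radius_pos d (n + 1) s).le c) h5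

/-! ### Truncated logarithms -/

/-- Truncation to the interval `[-A, A]`. -/
def clamp (A t : ℝ) : ℝ := max (-A) (min t A)

/-- Layer cake: `clamp A t` exceeds -A by the length of the part of (-A, A] below t. Truncated means
thereby become integrals of survival functions. -/
lemma clamp_eq_integral (A t : ℝ) :
    clamp A t = -A + ∫ s in Set.Ioc (-A) A, (Set.Iio t).indicator (fun _ => (1 : ℝ)) s := by
  rw [integral_indicator_const _ measurableSet_Iio, measureReal_restrict_apply measurableSet_Iio]
  have h : volume.real (Set.Iio t ∩ Set.Ioc (-A) A) = volume.real (Set.Ioc (-A) (min t A)) := by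
    have : (Set.Iio t ∩ Set.Ioc (-A) A : Set ℝ) =ᵐ[volume] Set.Ioc (-A) (min t A) := by
      have h1 : (Set.Iio t : Set ℝ) =ᵐ[volume] Set.Iic t := Iio_ae_eq_Iic
      refine (h1.inter (EventuallyEq.refl _ (Set.Ioc (-A) A))).trans (Eventually.of_forall ?_)
      intro s
      apply propext
      show (s ≤ t ∧ (-A < s ∧ s ≤ A)) ↔ (-A < s ∧ s ≤ min t A)
      rw [le_min_iff]
      tauto
    exact measureReal_congr this
  rw [h, Real.volume_real_Ioc, smul_eq_mul, mul_one, clamp]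
  rcases le_total (-A) (min t A) with h1 | h1
  · rw [max_eq_right h1, max_eq_left (by linarith)]; ring
  · rw [max_eq_left h1, max_eq_right (by linarith)]; ring

lemma abs_clamp_le {A : ℝ} (hA : 0 ≤ A) (t : ℝ) : |clamp A t| ≤ |t| := by
  unfold clamp
  rcases le_total t A with h | h <;> rcases le_total (-A) t with h' | h'
  · rw [min_eq_left h, max_eq_right h']
  · rw [min_eq_left h, max_eq_left h', abs_neg, abs_of_nonneg hA, abs_of_nonpos (by linarith)]
    linarith
  · rw [min_eq_right h, max_eq_right (by linarith), abs_of_nonneg hA, abs_of_nonneg (by linarith)]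
    exact h
  · rw [min_eq_right h, max_eq_right (by linarith), abs_of_nonneg hA, abs_of_nonneg (by linarith)]
    exact h

lemma abs_sub_clamp {A : ℝ} (hA : 0 ≤ A) (t : ℝ) : |t - clamp A t| = max (|t| - A) 0 := by
  unfold clamp
  rcases le_total t A with h | h <;> rcases le_total (-A) t with h' | h'
  · rw [min_eq_left h, max_eq_right h', sub_self, abs_zero, max_eq_right]
    linarith [abs_le.2 ⟨h', h⟩]
  · rw [min_eq_left h, max_eq_left h', abs_of_nonpos (by linarith), abs_of_nonpos (by linarith),
      max_eq_left (by linarith)]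
    ring
  · rw [min_eq_right h, max_eq_right (by linarith), abs_of_nonneg (by linarith),
      abs_of_nonneg (by linarith), max_eq_left (by linarith)]
  · rw [min_eq_right h, max_eq_right (by linarith), abs_of_nonneg (by linarith),
      abs_of_nonneg (by linarith), max_eq_left (by linarith)]

lemma continuous_clamp (A : ℝ) : Continuous (clamp A) := by
  unfold clamp
  fun_prop

lemma tendsto_clamp (t : ℝ) : Tendsto (fun A => clamp A t) atTop (𝓝 t) := by
  refine tendsto_const_nhds.congr' ?_
  filter_upwards [eventually_ge_atTop |t|] with A hA
  rw [clamp, min_eq_left ((le_abs_self t).trans hA),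
    max_eq_right (by linarith [neg_abs_le t])]

/-- The logarithm of the rescaled nearest neighbour distance. -/
def logSpacing {n : ℕ} (x : Fin (n + 2) → E d) (i : Fin (n + 2)) : ℝ :=
  Real.log (n + 1 : ℕ) + Real.log (unitBallVolume d) + d * Real.log (nearestDist x i)

lemma measurable_logSpacing {n : ℕ} (i : Fin (n + 2)) :
    Measurable fun x : Fin (n + 2) → E d => logSpacing x i :=
  ((measurable_nearestDist i).log.const_mul _).const_add _

/-- Positivity matters: for coinciding points the convention `Real.log 0 = 0` would break the
equivalence. -/
lemma radius_lt_nearestDist_iff (hd : 0 < d) {n : ℕ} (x : Fin (n + 2) → E d) (i : Fin (n + 2))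
    (h : 0 < nearestDist x i) (s : ℝ) :
    radius d (n + 1) s < nearestDist x i ↔ s < logSpacing x i := by
  have hd' : (0 : ℝ) < d := by exact_mod_cast hd
  rw [radius, ← Real.lt_log_iff_exp_lt h, div_lt_iff₀ hd', logSpacing]
  constructor <;> intro h <;> linarith

lemma mean_clamp_logSpacing (hd : 0 < d) {n : ℕ} {A : ℝ} (x : Fin (n + 2) → E d)
    (h : ∀ i, 0 < nearestDist x i) :
    (∑ i, clamp A (logSpacing x i)) / (n + 2 : ℕ)
      = -A + ∫ s in Set.Ioc (-A) A, isolFrac (radius d (n + 1) s) x := by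
  simp_rw [clamp_eq_integral, isolFrac]
  rw [integral_div, integral_finsetSum, Finset.sum_add_distrib, add_div]
  · congr 1
    · simp
      field_simp
    · congr 1
      refine Finset.sum_congr rfl fun i _ => ?_
      congr 1
      funext s
      simp [Set.indicator, radius_lt_nearestDist_iff hd x i (h i)]
  · intro i _
    have : (fun s => {x : Fin (n + 2) → E d | radius d (n + 1) s < nearestDist x i}.indicator
        (fun _ => (1 : ℝ)) x) = (Set.Iio (logSpacing x i)).indicator fun _ => (1 : ℝ) := by
      funext s
      simp [Set.indicator, radius_lt_nearestDist_iff hd x i (h i)]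
    rw [this]
    exact (integrable_const _).indicator measurableSet_Iio

/-- Cauchy-Schwarz against the constant 1, read off from ∫ (m g - I)² ≥ 0 with m the total mass and
I = ∫ g. -/
lemma sq_integral_le {α : Type*} [MeasurableSpace α] (ν : Measure α) [IsFiniteMeasure ν]
    {g : α → ℝ} (hg : Integrable g ν) (hg2 : Integrable (fun a => g a ^ 2) ν) :
    (∫ a, g a ∂ν) ^ 2 ≤ ν.real Set.univ * ∫ a, g a ^ 2 ∂ν := by
  rcases eq_or_ne ν 0 with rfl | hν
  · simp
  set m := ν.real Set.univ
  have hm : 0 < m := by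
    refine ENNReal.toReal_pos (by simpa using hν) (measure_ne_top _ _)
  set I := ∫ a, g a ∂ν
  have h : 0 ≤ ∫ a, (m * g a - I) ^ 2 ∂ν := integral_nonneg fun _ => sq_nonneg _
  have h2 : ∫ a, (m * g a - I) ^ 2 ∂ν = m * (m * ∫ a, g a ^ 2 ∂ν - I ^ 2) := by
    calc ∫ a, (m * g a - I) ^ 2 ∂ν = ∫ a, (m ^ 2 * g a ^ 2 - 2 * m * I * g a + I ^ 2) ∂ν := by
          congr 1; funext a; ring
      _ = m ^ 2 * ∫ a, g a ^ 2 ∂ν - 2 * m * I * I + m * I ^ 2 := by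
          rw [integral_add (by exact (hg2.const_mul _).sub (hg.const_mul _)) (integrable_const _),
            integral_sub (hg2.const_mul _) (hg.const_mul _), integral_const_mul,
            integral_const_mul, integral_const, smul_eq_mul]
      _ = _ := by ring
  rw [h2] at h
  have := nonneg_of_mul_nonneg_right h hm
  linarith

/-- The limit of the mean of the truncated logarithms. -/
def clampLimit (f : E d → ℝ) (A : ℝ) : ℝ := -A + ∫ s in Set.Ioc (-A) A, isolLimit f s

lemma measurable_uncurry_isolFrac (n : ℕ) :
    Measurable fun p : (Fin (n + 2) → E d) × ℝ => isolFrac (radius d (n + 1) p.2) p.1 := by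
  unfold isolFrac
  refine (Finset.measurable_fun_sum _ fun i _ => ?_).div_const _
  have h : MeasurableSet {p : (Fin (n + 2) → E d) × ℝ |
      radius d (n + 1) p.2 < nearestDist p.1 i} :=
    measurableSet_lt ((measurable_radius d (n + 1)).comp measurable_snd)
      ((measurable_nearestDist i).comp measurable_fst)
  exact (measurable_const (a := (1 : ℝ))).indicator h

/-- The error is the integral over s in (-A, A] of empirical minus limiting survival function.
Cauchy-Schwarz bounds its square by 2A times the integral of the squares; Fubini and dominated
convergence then use the convergence at each s. -/
lemma IsProbDensity.tendsto_integral_clamp_sub_sq (hd : 0 < d) (hf : IsProbDensity f) {A : ℝ}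
    (hA : 0 ≤ A) (hpos : ∀ n : ℕ, ∀ᵐ x ∂sampleLaw (law f) (n + 2), ∀ i, 0 < nearestDist x i) :
    Tendsto (fun n : ℕ => ∫ x, ((∑ i, clamp A (logSpacing x i)) / (n + 2 : ℕ) - clampLimit f A) ^ 2
      ∂sampleLaw (law f) (n + 2)) atTop (𝓝 0) := by
  have := hf.isProbabilityMeasure_law
  set ν : Measure ℝ := volume.restrict (Set.Ioc (-A) A) with hν
  have hνm : ν.real Set.univ = 2 * A := by
    rw [hν, measureReal_restrict_apply MeasurableSet.univ, Set.univ_inter, Real.volume_real_Ioc,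
      max_eq_left (by linarith)]
    ring
  have hgm : ∀ n : ℕ, Measurable fun p : (Fin (n + 2) → E d) × ℝ =>
      isolFrac (radius d (n + 1) p.2) p.1 - isolLimit f p.2 := fun n =>
    (measurable_uncurry_isolFrac n).sub (hf.measurable_isolLimit.comp measurable_snd)
  have hgb : ∀ (n : ℕ) (x : Fin (n + 2) → E d) (s : ℝ),
      |isolFrac (radius d (n + 1) s) x - isolLimit f s| ≤ 1 := fun n x s => by
    have h1 := isolFrac_nonneg (radius d (n + 1) s) x
    have h2 := isolFrac_le_one (radius d (n + 1) s) x
    have h3 := isolLimit_nonneg f s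
    have h4 := hf.isolLimit_le_one s
    exact abs_le.2 ⟨by linarith, by linarith⟩
  have hsqb : ∀ (n : ℕ) (x : Fin (n + 2) → E d) (s : ℝ),
      ‖(isolFrac (radius d (n + 1) s) x - isolLimit f s) ^ 2‖ ≤ 1 := fun n x s => by
    rw [Real.norm_of_nonneg (sq_nonneg _), ← sq_abs]
    exact pow_le_one₀ (abs_nonneg _) (hgb n x s)
  have hprod : ∀ n : ℕ, Integrable (fun p : (Fin (n + 2) → E d) × ℝ =>
      (isolFrac (radius d (n + 1) p.2) p.1 - isolLimit f p.2) ^ 2)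
      ((sampleLaw (law f) (n + 2)).prod ν) := fun n =>
    Integrable.of_bound ((hgm n).pow_const 2).aestronglyMeasurable 1
      (ae_of_all _ fun p => hsqb n p.1 p.2)
  have hlim : Tendsto (fun n : ℕ => ∫ s, ∫ x, (isolFrac (radius d (n + 1) s) x - isolLimit f s) ^ 2
      ∂sampleLaw (law f) (n + 2) ∂ν) atTop (𝓝 (∫ _s, (0 : ℝ) ∂ν)) := by
    refine tendsto_integral_of_dominated_convergence (fun _ => 1)
      (fun n => (hprod n).swap.integral_prod_left.aestronglyMeasurable) (integrable_const _)
      (fun n => ae_of_all _ fun s => ?_) (ae_of_all _ fun s =>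
        hf.tendsto_integral_isolFrac_sub_sq hd s)
    refine (norm_integral_le_of_norm_le_const (ae_of_all _ fun x => hsqb n x s)).trans ?_
    simp
  rw [integral_zero] at hlim
  have hlim2 := hlim.const_mul (2 * A)
  rw [mul_zero] at hlim2
  refine squeeze_zero (fun n => integral_nonneg fun _ => sq_nonneg _) (fun n => ?_) hlim2
  rw [← integral_integral_swap (f := fun x s =>
    (isolFrac (radius d (n + 1) s) x - isolLimit f s) ^ 2) (hprod n), ← integral_const_mul]
  refine integral_mono_of_nonneg (ae_of_all _ fun _ => sq_nonneg _)
    ((hprod n).integral_prod_left.const_mul _) ?_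
  filter_upwards [hpos n] with x hx
  have hm1 : Integrable (fun s => isolFrac (radius d (n + 1) s) x) ν :=
    Integrable.of_bound ((measurable_uncurry_isolFrac n).comp
      measurable_prodMk_left).aestronglyMeasurable 1 (ae_of_all _ fun s => by
        rw [Real.norm_of_nonneg (isolFrac_nonneg _ _)]; exact isolFrac_le_one _ _)
  have hm2 : Integrable (isolLimit f) ν :=
    Integrable.of_bound hf.measurable_isolLimit.aestronglyMeasurable 1 (ae_of_all _ fun s => by
        rw [Real.norm_of_nonneg (isolLimit_nonneg _ _)]; exact hf.isolLimit_le_one _)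
  rw [mean_clamp_logSpacing hd x hx, clampLimit, ← hνm, add_sub_add_left_eq_sub,
    ← integral_sub hm1 hm2]
  exact sq_integral_le ν (hm1.sub hm2) (Integrable.of_bound
    (((hgm n).comp measurable_prodMk_left).pow_const 2).aestronglyMeasurable 1
    (ae_of_all _ fun s => hsqb n x s))

end KozachenkoLeonenko

end

noncomputable section

namespace KozachenkoLeonenko

/-! ### The limit of the truncated means -/

/-- The standard exponential distribution. -/
def stdExp : Measure ℝ :=
  (volume.restrict (Set.Ioi 0)).withDensity fun t => ENNReal.ofReal (Real.exp (-t))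

lemma measurable_ofReal_exp_neg : Measurable fun t : ℝ => ENNReal.ofReal (Real.exp (-t)) := by
  fun_prop

lemma integral_stdExp (g : ℝ → ℝ) :
    ∫ t, g t ∂stdExp = ∫ t in Set.Ioi (0 : ℝ), Real.exp (-t) * g t := by
  rw [stdExp, integral_withDensity_eq_integral_toReal_smul measurable_ofReal_exp_neg
    (ae_of_all _ fun _ => ENNReal.ofReal_lt_top)]
  simp [ENNReal.toReal_ofReal (Real.exp_pos _).le]

lemma integrable_stdExp_iff (g : ℝ → ℝ) :
    Integrable g stdExp ↔ IntegrableOn (fun t => Real.exp (-t) * g t) (Set.Ioi 0) := by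
  rw [stdExp, integrable_withDensity_iff_integrable_smul' measurable_ofReal_exp_neg
    (ae_of_all _ fun _ => ENNReal.ofReal_lt_top)]
  simp [ENNReal.toReal_ofReal (Real.exp_pos _).le, IntegrableOn]

lemma stdExp_Ioi {a : ℝ} (ha : 0 ≤ a) :
    stdExp (Set.Ioi a) = ENNReal.ofReal (Real.exp (-a)) := by
  rw [stdExp, withDensity_apply _ measurableSet_Ioi, Measure.restrict_restrict measurableSet_Ioi,
    Set.inter_eq_left.2 (Set.Ioi_subset_Ioi ha), ← integral_exp_neg_Ioi,
    ofReal_integral_eq_lintegral_ofReal]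
  · simpa [IntegrableOn] using exp_neg_integrableOn_Ioi a one_pos
  · exact ae_of_all _ fun _ => (Real.exp_pos _).le

lemma ae_pos_stdExp : ∀ᵐ t ∂stdExp, 0 < t :=
  (withDensity_absolutelyContinuous _ _).ae_le (ae_restrict_mem measurableSet_Ioi)

instance isProbabilityMeasure_stdExp : IsProbabilityMeasure stdExp := by
  refine ⟨?_⟩
  have h : stdExp Set.univ = stdExp (Set.Ioi 0) := by
    refine measure_congr ?_
    filter_upwards [ae_pos_stdExp] with t ht
    exact propext ⟨fun _ => ht, fun _ => trivial⟩
  rw [h, stdExp_Ioi le_rfl]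
  simp

/-- From log u ≤ u - 1 at u = t and u = t^(-1/2). It dominates e^{-t} |log t| by the integrands of
Γ(2) and Γ(1/2). -/
lemma abs_log_le_add_rpow {t : ℝ} (ht : 0 < t) : |Real.log t| ≤ t + 2 * t ^ (-(1 / 2) : ℝ) := by
  have h0 : 0 < t ^ (-(1 / 2) : ℝ) := Real.rpow_pos_of_pos ht _
  rw [abs_le]
  constructor
  · have h1 := Real.log_le_sub_one_of_pos h0
    rw [Real.log_rpow ht] at h1
    linarith
  · have h1 := Real.log_le_sub_one_of_pos ht
    linarith

lemma integrable_log_stdExp : Integrable Real.log stdExp := by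
  rw [integrable_stdExp_iff]
  have h1 := Real.GammaIntegral_convergent (s := 2) two_pos
  have h2 := Real.GammaIntegral_convergent (s := 1 / 2) (by norm_num)
  refine Integrable.mono' (h1.add (h2.const_mul 2)) (by fun_prop) ?_
  filter_upwards [ae_restrict_mem measurableSet_Ioi] with t ht
  have ht' : (0 : ℝ) < t := ht
  have h3 := abs_log_le_add_rpow ht'
  have h4 : (1 / 2 - 1 : ℝ) = -(1 / 2) := by norm_num
  have h5 : (2 - 1 : ℝ) = 1 := by norm_num
  rw [norm_mul, Real.norm_of_nonneg (Real.exp_pos _).le, Real.norm_eq_abs, Pi.add_apply, h4, h5,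
    Real.rpow_one]
  calc Real.exp (-t) * |Real.log t| ≤ Real.exp (-t) * (t + 2 * t ^ (-(1 / 2) : ℝ)) :=
        mul_le_mul_of_nonneg_left h3 (Real.exp_pos _).le
    _ = _ := by ring

lemma integral_log_stdExp : ∫ t, Real.log t ∂stdExp = -eulerConstant := by
  rw [integral_stdExp, eulerConstant, neg_neg]

/-! ### The limit law as that of log T - log g(X), with T standard exponential -/

section

variable {α : Type*} [MeasurableSpace α] (μ : Measure α) [IsProbabilityMeasure μ] {g : α → ℝ}

/-- For fixed x, exp(-g(x) e^s) is the probability that T > g(x) e^s, that is, log T - log g(x) > s.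
-/
lemma integral_exp_neg_mul_eq (hg : Measurable g) (hpos : ∀ᵐ x ∂μ, 0 < g x) (s : ℝ) :
    ∫ x, Real.exp (-(g x * Real.exp s)) ∂μ
      = ∫ p, (Set.Iio (Real.log p.2 - Real.log (g p.1))).indicator (fun _ => (1 : ℝ)) s
          ∂μ.prod stdExp := by
  have hS : MeasurableSet {p : α × ℝ | s < Real.log p.2 - Real.log (g p.1)} :=
    measurableSet_lt measurable_const (by fun_prop)
  have h1 : (fun p : α × ℝ =>
      (Set.Iio (Real.log p.2 - Real.log (g p.1))).indicator (fun _ => (1 : ℝ)) s)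
      = {p : α × ℝ | s < Real.log p.2 - Real.log (g p.1)}.indicator fun _ => 1 := by
    funext p
    simp [Set.indicator]
  rw [h1, integral_prod _ ((integrable_const _).indicator hS)]
  refine integral_congr_ae ?_
  filter_upwards [hpos] with x hx
  have h2 : (fun t => {p : α × ℝ | s < Real.log p.2 - Real.log (g p.1)}.indicator
      (fun _ => (1 : ℝ)) (x, t)) =ᵐ[stdExp] (Set.Ioi (g x * Real.exp s)).indicator fun _ => 1 := by
    filter_upwards [ae_pos_stdExp] with t ht
    have h3 : s < Real.log t - Real.log (g x) ↔ g x * Real.exp s < t := by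
      rw [lt_sub_iff_add_lt, Real.lt_log_iff_exp_lt ht, Real.exp_add, Real.exp_log hx, mul_comm]
    simp [Set.indicator, h3]
  rw [integral_congr_ae h2, integral_indicator_const _ measurableSet_Ioi, measureReal_def,
    stdExp_Ioi (mul_pos hx (Real.exp_pos s)).le, ENNReal.toReal_ofReal (Real.exp_pos _).le]
  simp

lemma neg_add_integral_integral_exp_eq (hg : Measurable g) (hpos : ∀ᵐ x ∂μ, 0 < g x) {A : ℝ} :
    -A + ∫ s in Set.Ioc (-A) A, ∫ x, Real.exp (-(g x * Real.exp s)) ∂μ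
      = ∫ p, clamp A (Real.log p.2 - Real.log (g p.1)) ∂μ.prod stdExp := by
  simp_rw [integral_exp_neg_mul_eq μ hg hpos, clamp_eq_integral]
  have hS : MeasurableSet {q : ℝ × (α × ℝ) | q.1 < Real.log q.2.2 - Real.log (g q.2.1)} :=
    measurableSet_lt (by fun_prop) (by fun_prop)
  have hint : Integrable (fun q : ℝ × (α × ℝ) =>
      (Set.Iio (Real.log q.2.2 - Real.log (g q.2.1))).indicator (fun _ => (1 : ℝ)) q.1)
      ((volume.restrict (Set.Ioc (-A) A)).prod (μ.prod stdExp)) := by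
    have h1 : (fun q : ℝ × (α × ℝ) =>
        (Set.Iio (Real.log q.2.2 - Real.log (g q.2.1))).indicator (fun _ => (1 : ℝ)) q.1)
        = {q : ℝ × (α × ℝ) | q.1 < Real.log q.2.2 - Real.log (g q.2.1)}.indicator fun _ => 1 := by
      funext q
      simp [Set.indicator]
    rw [h1]
    exact (integrable_const _).indicator hS
  rw [integral_integral_swap (f := fun (s : ℝ) (p : α × ℝ) =>
    (Set.Iio (Real.log p.2 - Real.log (g p.1))).indicator (fun _ => (1 : ℝ)) s) hint,
    integral_add (integrable_const _) hint.integral_prod_right]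
  simp

/-- By the layer cake formula the left side is the expectation of log T - log g(X) truncated at ±A;
the truncation is removed by dominated convergence, and E log T = -γ. -/
lemma tendsto_neg_add_integral_integral_exp (hg : Measurable g) (hpos : ∀ᵐ x ∂μ, 0 < g x)
    (hlog : Integrable (fun x => Real.log (g x)) μ) :
    Tendsto (fun A => -A + ∫ s in Set.Ioc (-A) A, ∫ x, Real.exp (-(g x * Real.exp s)) ∂μ) atTop
      (𝓝 (-∫ x, Real.log (g x) ∂μ - eulerConstant)) := by
  simp_rw [neg_add_integral_integral_exp_eq μ hg hpos]
  have hi1 : Integrable (fun p : α × ℝ => Real.log p.2) (μ.prod stdExp) :=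
    integrable_log_stdExp.comp_snd μ
  have hi2 : Integrable (fun p : α × ℝ => Real.log (g p.1)) (μ.prod stdExp) :=
    hlog.comp_fst stdExp
  have hval : ∫ p, (Real.log p.2 - Real.log (g p.1)) ∂μ.prod stdExp
      = -∫ x, Real.log (g x) ∂μ - eulerConstant := by
    rw [integral_sub hi1 hi2, integral_fun_snd, integral_fun_fst fun x => Real.log (g x), integral_log_stdExp]
    simp
    ring
  rw [← hval]
  refine tendsto_integral_filter_of_dominated_convergence
    (fun p => |Real.log p.2 - Real.log (g p.1)|) ?_ ?_ (hi1.sub hi2).abs ?_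
  · exact Eventually.of_forall fun A => ((continuous_clamp A).measurable.comp
      (by fun_prop)).aestronglyMeasurable
  · filter_upwards [eventually_ge_atTop 0] with A hA
    exact ae_of_all _ fun p => abs_clamp_le hA _
  · exact ae_of_all _ fun p => tendsto_clamp _

end

variable {d : ℕ} {f : E d → ℝ}

lemma IsProbDensity.integrable_law_iff (hf : IsProbDensity f) (g : E d → ℝ) :
    Integrable g (law f) ↔ Integrable (fun x => f x * g x) := by
  rw [law, integrable_withDensity_iff_integrable_smul₀' hf.aemeasurable_ofReal
    (ae_of_all _ fun _ => ENNReal.ofReal_lt_top)]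
  simp [ENNReal.toReal_ofReal (hf.2.1 _)]

lemma IsProbDensity.integral_law (hf : IsProbDensity f) (g : E d → ℝ) :
    ∫ x, g x ∂law f = ∫ x, f x * g x := by
  rw [law, integral_withDensity_eq_integral_toReal_smul₀ hf.aemeasurable_ofReal
    (ae_of_all _ fun _ => ENNReal.ofReal_lt_top)]
  simp [ENNReal.toReal_ofReal (hf.2.1 _)]

lemma IsProbDensity.tendsto_clampLimit (hf : IsProbDensity f) (hH : HasFiniteEntropy f) :
    Tendsto (clampLimit f) atTop (𝓝 (entropy f - eulerConstant)) := by
  have := hf.isProbabilityMeasure_law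
  have hae := hf.aemeasurable_law.ae_eq_mk
  have h := tendsto_neg_add_integral_integral_exp (law f) hf.aemeasurable_law.measurable_mk
    (by filter_upwards [hae, hf.ae_pos_law] with x hx hx2; rwa [← hx])
    (((hf.integrable_law_iff _).2 hH).congr
      (by filter_upwards [hae] with x hx; rw [← hx]))
  have h1 : ∫ x, Real.log (hf.aemeasurable_law.mk f x) ∂law f = ∫ x, Real.log (f x) ∂law f :=
    integral_congr_ae (by filter_upwards [hae] with x hx; rw [← hx])
  rw [h1, hf.integral_law] at h
  refine h.congr fun A => ?_
  rw [clampLimit]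
  congr 1
  refine setIntegral_congr_fun measurableSet_Ioc fun s _ => ?_
  refine integral_congr_ae ?_
  filter_upwards [hae] with x hx
  rw [← hx]

end KozachenkoLeonenko

end

noncomputable section

namespace KozachenkoLeonenko

/-! ### Consequences of the moment conditions -/

variable {d : ℕ} {f : E d → ℝ}

/-- The law with density `f` has a finite second logarithmic moment. -/
def HasLogSqMoment (f : E d → ℝ) : Prop :=
  ∫⁻ y, ENNReal.ofReal (Real.log (1 + ‖y‖) ^ 2) ∂law f < ∞

/-- By the triangle inequality 1 + ‖y‖ ≤ (1 + ‖x‖)(1 + ρ) with ρ the distance, and log(1 + ρ) ≤ log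
2 + |log ρ|. Distances to one fixed x thus control the norm. -/
lemma log_one_add_norm_sq_le (x y : E d) :
    Real.log (1 + ‖y‖) ^ 2
      ≤ 2 * (Real.log (1 + ‖x‖) + Real.log 2) ^ 2 + 2 * Real.log (dist x y) ^ 2 := by
  have hx := norm_nonneg x
  have hy := norm_nonneg y
  have ht : 0 ≤ dist x y := dist_nonneg
  have hyx : ‖y‖ ≤ ‖x‖ + dist x y := by
    have := norm_sub_norm_le y x
    rw [dist_comm, dist_eq_norm]
    linarith
  have h1 : Real.log (1 + ‖y‖) ≤ Real.log (1 + ‖x‖) + Real.log (1 + dist x y) := by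
    rw [← Real.log_mul (by positivity) (by positivity)]
    exact Real.log_le_log (by positivity) (by nlinarith)
  have h2 : Real.log (1 + dist x y) ≤ Real.log 2 + |Real.log (dist x y)| := by
    rcases le_total (dist x y) 1 with h | h
    · have : Real.log (1 + dist x y) ≤ Real.log 2 :=
        Real.log_le_log (by positivity) (by linarith)
      linarith [abs_nonneg (Real.log (dist x y))]
    · have : Real.log (1 + dist x y) ≤ Real.log (2 * dist x y) :=
        Real.log_le_log (by positivity) (by linarith)
      rw [Real.log_mul two_ne_zero (by positivity)] at this
      linarith [le_abs_self (Real.log (dist x y))]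
  have h3 : 0 ≤ Real.log (1 + ‖y‖) := Real.log_nonneg (by linarith)
  have h4 : Real.log (1 + ‖y‖) ≤ (Real.log (1 + ‖x‖) + Real.log 2) + |Real.log (dist x y)| := by
    linarith
  have h5 := pow_le_pow_left₀ h3 h4 2
  rw [← sq_abs (Real.log (dist x y))]
  nlinarith [sq_nonneg ((Real.log (1 + ‖x‖) + Real.log 2) - |Real.log (dist x y)|)]

lemma le_exp_one_add_G {u : ℝ} : u ≤ Real.exp 1 + G u := by
  have he : 1 < Real.exp 1 := Real.one_lt_exp_iff.2 one_pos
  unfold G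
  split_ifs with h
  · linarith
  · push Not at h
    rcases le_total u (Real.exp 1) with h1 | h1
    · nlinarith [Real.log_nonneg h]
    · have : 1 ≤ Real.log u := (Real.le_log_iff_exp_le (by linarith)).2 h1
      nlinarith

lemma sq_le_one_add_abs_rpow {p : ℝ} (hp : 2 < p) (l : ℝ) : l ^ 2 ≤ 1 + |l| ^ p := by
  have h0 : 0 ≤ |l| ^ p := Real.rpow_nonneg (abs_nonneg l) p
  rw [← sq_abs]
  rcases le_total |l| 1 with h | h
  · have := pow_le_one₀ (n := 2) (abs_nonneg l) h
    linarith
  · have := Real.rpow_le_rpow_of_exponent_le h hp.le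
    rw [Real.rpow_two] at this
    linarith

/-- Extracts from a finite double integral a single reference point x whose inner integral is
finite. -/
lemma IsProbDensity.exists_lt_top (hf : IsProbDensity f) {Φ : E d → ℝ≥0∞}
    (h : ∫⁻ x, Φ x * ENNReal.ofReal (f x) < ∞) : ∃ x, 0 < f x ∧ Φ x < ∞ := by
  have := hf.isProbabilityMeasure_law
  by_contra! hc
  rw [← hf.lintegral_law] at h
  have h2 : ∫⁻ x, Φ x ∂law f = ∫⁻ _x, ∞ ∂law f := by
    refine lintegral_congr_ae ?_
    filter_upwards [hf.ae_pos_law] with x hx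
    exact top_le_iff.1 (hc x hx)
  rw [h2] at h
  simp at h

/-- A bound of `log²` of the distance to one fixed point gives the second logarithmic moment. -/
lemma IsProbDensity.hasLogSqMoment_of_le (hf : IsProbDensity f) (x : E d) (C : ℝ)
    {φ : E d → ℝ} (hle : ∀ y, Real.log (dist x y) ^ 2 ≤ C + φ y)
    (hfin : ∫⁻ y, ENNReal.ofReal (φ y) * ENNReal.ofReal (f y) < ∞) : HasLogSqMoment f := by
  have := hf.isProbabilityMeasure_law
  rw [← hf.lintegral_law] at hfin
  set D := 2 * (Real.log (1 + ‖x‖) + Real.log 2) ^ 2 + 2 * C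
  have hbound : ∀ y, ENNReal.ofReal (Real.log (1 + ‖y‖) ^ 2)
      ≤ ENNReal.ofReal D + ENNReal.ofReal 2 * ENNReal.ofReal (φ y) := fun y => by
    rw [← ENNReal.ofReal_mul two_pos.le]
    refine le_trans (ENNReal.ofReal_le_ofReal ?_) ENNReal.ofReal_add_le
    have := log_one_add_norm_sq_le x y
    have := hle y
    simp only [D]
    linarith
  refine (lintegral_mono hbound).trans_lt ?_
  rw [lintegral_add_left measurable_const, lintegral_const_mul' _ _ ENNReal.ofReal_ne_top]
  refine ENNReal.add_lt_top.2 ⟨?_, ENNReal.mul_lt_top ENNReal.ofReal_lt_top hfin⟩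
  simp

lemma IsProbDensity.hasLogSqMoment_of_K₂ (hf : IsProbDensity f) {ε : ℝ} (hε : 0 < ε)
    (h : K₂ f ε < ∞) : HasLogSqMoment f := by
  obtain ⟨x, -, hx⟩ := hf.exists_lt_top h
  rw [ENNReal.rpow_lt_top_iff_of_pos (by linarith)] at hx
  exact hf.hasLogSqMoment_of_le x (Real.exp 1) (fun y => le_exp_one_add_G) hx

lemma IsProbDensity.hasLogSqMoment_of_logMoment (hf : IsProbDensity f) {p : ℝ} (hp : 2 < p)
    (h : logMoment f p < ∞) : HasLogSqMoment f := by
  have h2 : logMoment f p = ∫⁻ x, (∫⁻ y, ENNReal.ofReal (|Real.log (dist x y)| ^ p) *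
      ENNReal.ofReal (f y)) * ENNReal.ofReal (f x) := by
    refine lintegral_congr fun x => ?_
    rw [← lintegral_mul_const' _ _ ENNReal.ofReal_ne_top]
    exact lintegral_congr fun y => by ring
  rw [h2] at h
  obtain ⟨x, -, hx⟩ := hf.exists_lt_top h
  exact hf.hasLogSqMoment_of_le x 1 (fun y => sq_le_one_add_abs_rpow hp _) hx

lemma HasBoundedSupport.hasLogSqMoment (hf : IsProbDensity f) (h : HasBoundedSupport f) :
    HasLogSqMoment f := by
  have := hf.isProbabilityMeasure_law
  obtain ⟨g, ⟨-, hgf⟩, hb⟩ := h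
  obtain ⟨R, hR⟩ := hb.exists_norm_le
  have hae : ∀ᵐ y ∂law f, ENNReal.ofReal (Real.log (1 + ‖y‖) ^ 2)
      ≤ ENNReal.ofReal (Real.log (1 + R) ^ 2) := by
    filter_upwards [hf.ae_pos_law, (law_absolutelyContinuous f).ae_le hgf] with y hy hgy
    have h1 : ‖y‖ ≤ R := hR y (by show 0 < g y; rwa [hgy])
    have h2 := norm_nonneg y
    exact ENNReal.ofReal_le_ofReal (pow_le_pow_left₀ (Real.log_nonneg (by linarith))
      (Real.log_le_log (by linarith) (by linarith)) 2)
  refine (lintegral_mono_ae hae).trans_lt ?_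
  simp

lemma CondB.exists_Q_lt_top (hd : 0 < d) (hf : IsProbDensity f) (h : CondB f) :
    ∃ ε R : ℝ, 0 < ε ∧ 0 < R ∧ Q f ε R < ∞ := by
  obtain ⟨g, ⟨-, hgf⟩, M, hM, hg⟩ := h
  refine ⟨1, 1, one_pos, one_pos, ?_⟩
  have hsup : ∀ x, supMean f x 1 ≤ ENNReal.ofReal M := fun x => by
    refine iSup₂_le fun r hr => ?_
    refine ENNReal.div_le_of_le_mul ?_
    rw [← volume_closedBall_eq hd x hr.1.le, ← setLIntegral_const]
    refine lintegral_mono_ae (ae_restrict_of_ae ?_)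
    filter_upwards [hgf] with y hy
    rw [← hy]
    exact ENNReal.ofReal_le_ofReal (hg y)
  calc Q f 1 1 ≤ ∫⁻ x, ENNReal.ofReal M * ENNReal.ofReal (f x) :=
        lintegral_mono fun x => by
          rw [ENNReal.rpow_one]
          gcongr
          exact hsup x
    _ < ∞ := by
        rw [lintegral_const_mul' _ _ ENNReal.ofReal_ne_top, hf.2.2, mul_one]
        exact ENNReal.ofReal_lt_top

/-- The lower tail estimate interpolates between kp and 1, which requires an exponent at most 1;
lowering the exponent costs at most an added constant 1. -/
lemma IsProbDensity.exists_Q_lt_top_le_one (hf : IsProbDensity f) {ε R : ℝ} (hε : 0 < ε)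
    (hQ : Q f ε R < ∞) : ∃ ε' : ℝ, 0 < ε' ∧ ε' ≤ 1 ∧ Q f ε' R < ∞ := by
  have := hf.isProbabilityMeasure_law
  refine ⟨min ε 1, lt_min hε one_pos, min_le_right _ _, ?_⟩
  rw [Q, ← hf.lintegral_law] at hQ ⊢
  have hle : ∀ x, supMean f x R ^ min ε 1 ≤ 1 + supMean f x R ^ ε := fun x => by
    rcases le_total (supMean f x R) 1 with h | h
    · exact (ENNReal.rpow_le_one h (lt_min hε one_pos).le).trans le_self_add
    · exact (ENNReal.rpow_le_rpow_of_exponent_le h (min_le_left _ _)).trans le_add_self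
  refine (lintegral_mono hle).trans_lt ?_
  rw [lintegral_add_left measurable_const]
  refine ENNReal.add_lt_top.2 ⟨?_, hQ⟩
  simp

lemma IsProbDensity.ae_ofReal_le_supMean (hd : 0 < d) (hf : IsProbDensity f) {R : ℝ}
    (hR : 0 < R) : ∀ᵐ x : E d, ENNReal.ofReal (f x) ≤ supMean f x R := by
  filter_upwards [hf.ae_tendsto_ballMean hd] with x hx
  refine le_of_tendsto hx ?_
  filter_upwards [Ioc_mem_nhdsGT hR] with r hr
  exact le_iSup₂ (f := fun r (_ : r ∈ Set.Ioc (0 : ℝ) R) => ballMean f x r) r hr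

/-- The entropy integral converges absolutely. -/
lemma IsProbDensity.hasFiniteEntropy (hd : 0 < d) (hf : IsProbDensity f)
    (hlog : HasLogSqMoment f) {ε R : ℝ} (hε : 0 < ε) (hR : 0 < R) (hQ : Q f ε R < ∞) :
    HasFiniteEntropy f := by
  have := hf.isProbabilityMeasure_law
  refine (hf.integrable_law_iff fun x => Real.log (f x)).1 ?_
  have hfm := hf.aemeasurable_law
  -- Since f is a.e. below its local maximal function, `Q` controls f^ε, and log f ≤ f^ε/ε bounds
  -- the positive part.
  have h1 : Integrable (fun x => f x ^ ε) (law f) := by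
    refine ⟨(hfm.pow_const ε).aestronglyMeasurable, ?_⟩
    rw [hasFiniteIntegral_iff_ofReal (ae_of_all _ fun x => Real.rpow_nonneg (hf.2.1 x) _)]
    rw [Q, ← hf.lintegral_law] at hQ
    refine (lintegral_mono_ae ?_).trans_lt hQ
    filter_upwards [(law_absolutelyContinuous f).ae_le (hf.ae_ofReal_le_supMean hd hR)] with x hx
    rw [← ENNReal.ofReal_rpow_of_nonneg (hf.2.1 x) hε.le]
    exact ENNReal.rpow_le_rpow hx hε.le
  have h2 : Integrable (fun x => Real.log (1 + ‖x‖)) (law f) := by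
    have hm : Measurable fun x : E d => Real.log (1 + ‖x‖) := by fun_prop
    have hsq : Integrable (fun x => Real.log (1 + ‖x‖) ^ 2) (law f) := by
      refine ⟨(hm.pow_const 2).aestronglyMeasurable, ?_⟩
      rw [hasFiniteIntegral_iff_ofReal (ae_of_all _ fun x => sq_nonneg _)]
      exact hlog
    refine (hsq.add (integrable_const 1)).mono' hm.aestronglyMeasurable (ae_of_all _ fun x => ?_)
    rw [Real.norm_eq_abs, Pi.add_apply, abs_le]
    constructor <;> nlinarith [sq_nonneg (Real.log (1 + ‖x‖) - 1), sq_nonneg (Real.log (1 + ‖x‖) + 1)]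
  -- A Lebesgue integrable comparison function: log(g/f) ≤ g/f gives -log f ≤ g/f + (d+1) log(1 +
  -- ‖x‖), and the expectation of g/f is at most ∫ g.
  set g : E d → ℝ := fun x => (1 + ‖x‖) ^ (-((d : ℝ) + 1)) with hg
  have hgpos : ∀ x, 0 < g x := fun x => Real.rpow_pos_of_pos (by positivity) _
  have hgint : Integrable g := integrable_one_add_norm (by simp)
  have h3 : Integrable (fun x => g x / f x) (law f) := by
    rw [hf.integrable_law_iff]
    refine hgint.mono' (hf.1.mul (hgint.aestronglyMeasurable.aemeasurable.div
      hf.1)).aestronglyMeasurable (ae_of_all _ fun x => ?_)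
    rw [Real.norm_of_nonneg (mul_nonneg (hf.2.1 x) (div_nonneg (hgpos x).le (hf.2.1 x)))]
    rcases eq_or_ne (f x) 0 with h | h
    · rw [h, zero_mul]; exact (hgpos x).le
    · rw [mul_div_cancel₀ _ h]
  refine (((h1.div_const ε).add h3).add (h2.const_mul ((d : ℝ) + 1))).mono'
    hfm.log.aestronglyMeasurable ?_
  filter_upwards [hf.ae_pos_law] with x hx
  simp only [Pi.add_apply]
  have h4 : 0 ≤ f x ^ ε / ε := div_nonneg (Real.rpow_nonneg hx.le _) hε.le
  have h5 : 0 ≤ g x / f x := div_nonneg (hgpos x).le hx.le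
  have h6 : 0 ≤ ((d : ℝ) + 1) * Real.log (1 + ‖x‖) :=
    mul_nonneg (by positivity) (Real.log_nonneg (by linarith [norm_nonneg x]))
  have h7 : Real.log (f x) ≤ f x ^ ε / ε := Real.log_le_rpow_div hx.le hε
  have h8 := Real.log_le_self (div_pos (hgpos x) hx).le
  rw [Real.log_div (hgpos x).ne' hx.ne', hg, Real.log_rpow (by positivity)] at h8
  rw [Real.norm_eq_abs, abs_le]
  constructor
  · simp only [hg] at h5 ⊢
    linarith
  · linarith

end KozachenkoLeonenko

end

noncomputable section

namespace KozachenkoLeonenko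

/-! ### Tail bounds for the nearest neighbour distances -/

/-! ### Covering a ball by small cubes -/

section Grid

variable {d : ℕ}

/-- The half-open cube with side `h` and index `z`. -/
def gridCell (h : ℝ) (z : Fin d → ℤ) : Set (E d) := {x | ∀ i, ⌊x i / h⌋ = z i}

lemma measurableSet_gridCell (h : ℝ) (z : Fin d → ℤ) : MeasurableSet (gridCell h z) := by
  unfold gridCell
  simp only [Set.ofPred_forall]
  refine MeasurableSet.iInter fun i => ?_
  have hm : Measurable fun x : E d => ⌊x i / h⌋ := Int.measurable_floor.comp (by fun_prop)
  exact hm (measurableSet_singleton (z i))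

lemma dist_le_of_mem_gridCell {h : ℝ} (hh : 0 < h) {z : Fin d → ℤ} {x y : E d}
    (hx : x ∈ gridCell h z) (hy : y ∈ gridCell h z) : dist x y ≤ d * h := by
  rw [EuclideanSpace.dist_eq]
  refine Real.sqrt_le_iff.2 ⟨by positivity, ?_⟩
  have hi : ∀ i, dist (x i) (y i) ^ 2 ≤ h ^ 2 := fun i => by
    refine pow_le_pow_left₀ dist_nonneg ?_ 2
    have h1 := Int.abs_sub_lt_one_of_floor_eq_floor ((hx i).trans (hy i).symm)
    rw [← sub_div, abs_div, abs_of_pos hh, div_lt_one hh] at h1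
    exact h1.le
  calc ∑ i, dist (x i) (y i) ^ 2 ≤ ∑ _i : Fin d, h ^ 2 := Finset.sum_le_sum fun i _ => hi i
    _ = d * h ^ 2 := by simp
    _ ≤ (d * h) ^ 2 := by
        rw [mul_pow]
        refine mul_le_mul_of_nonneg_right ?_ (sq_nonneg h)
        exact_mod_cast Nat.le_self_pow two_ne_zero d

/-- The indices of the cubes that meet a centred ball. -/
def gridIndex (d : ℕ) (K : ℕ) : Finset (Fin d → ℤ) :=
  Fintype.piFinset fun _ => Finset.Icc (-(K : ℤ)) K

lemma card_gridIndex (d K : ℕ) : (gridIndex d K).card = (2 * K + 1) ^ d := by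
  rw [gridIndex, Fintype.card_piFinset_const, Int.card_Icc]
  congr 1
  omega

lemma exists_mem_gridCell {h : ℝ} (hh : 0 < h) {l : ℝ} {x : E d} (hx : ‖x‖ ≤ l) :
    ∃ z ∈ gridIndex d ⌈l / h⌉₊, x ∈ gridCell h z := by
  refine ⟨fun i => ⌊x i / h⌋, ?_, fun i => rfl⟩
  refine Fintype.mem_piFinset.2 fun i => Finset.mem_Icc.2 ?_
  have h1 : |x i| ≤ l := (PiLp.norm_apply_le x i).trans hx
  have h2 : |x i / h| ≤ (⌈l / h⌉₊ : ℝ) := by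
    rw [abs_div, abs_of_pos hh]
    exact (div_le_div_of_nonneg_right h1 hh.le).trans (Nat.le_ceil _)
  rw [abs_le] at h2
  constructor
  · rw [Int.le_floor]; push_cast; exact h2.1
  · have : ((⌊x i / h⌋ : ℤ) : ℝ) ≤ ((⌈l / h⌉₊ : ℤ) : ℝ) := by
      push_cast; exact (Int.floor_le _).trans h2.2
    exact_mod_cast this

end Grid

/-! ### Upper bounds for the isolation probability -/

section Isol

variable {d : ℕ} (μ : Measure (E d)) [IsProbabilityMeasure μ]

/-- With u = kq, this is u e^{-u} ≤ 1 after (1-q)^k ≤ e^{-kq}. -/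
lemma mul_one_sub_pow_le {q : ℝ} (hq1 : q ≤ 1) {k : ℕ} (hk : 0 < k) :
    q * (1 - q) ^ k ≤ 1 / k := by
  have hk' : (0 : ℝ) < k := by exact_mod_cast hk
  rw [le_div_iff₀ hk']
  have h1 : (1 - q) ^ k ≤ Real.exp (-(k * q)) := by
    have := pow_le_pow_left₀ (by linarith) (Real.one_sub_le_exp_neg q) k
    rwa [← Real.exp_nat_mul, mul_neg] at this
  have h2 : k * q ≤ Real.exp (k * q) := by linarith [Real.add_one_le_exp (k * q)]
  calc q * (1 - q) ^ k * k = (k * q) * (1 - q) ^ k := by ring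
    _ ≤ Real.exp (k * q) * Real.exp (-(k * q)) := by
        refine mul_le_mul h2 h1 (pow_nonneg (by linarith) k) (Real.exp_pos _).le
    _ = 1 := by rw [← Real.exp_add]; simp

lemma isolProb_antitone (k : ℕ) {r s : ℝ} (h : r ≤ s) : isolProb μ k s ≤ isolProb μ k r :=
  integral_mono (integrable_isol μ k s) (integrable_isol μ k r) fun _ =>
    pow_le_pow_left₀ (sub_nonneg.2 measureReal_le_one)
      (sub_le_sub_left (measureReal_mono (Metric.closedBall_subset_closedBall h)) _) _

/-- A set of small diameter contains an isolated sample point only with small probability. -/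
lemma setIntegral_isol_le {k : ℕ} (hk : 0 < k) {r : ℝ} {C : Set (E d)} (hC : MeasurableSet C)
    (hdiam : ∀ x ∈ C, ∀ y ∈ C, dist x y ≤ r) :
    ∫ x in C, (1 - μ.real (Metric.closedBall x r)) ^ k ∂μ ≤ 1 / k := by
  calc ∫ x in C, (1 - μ.real (Metric.closedBall x r)) ^ k ∂μ
      ≤ ∫ _x in C, (1 - μ.real C) ^ k ∂μ := by
        refine setIntegral_mono_on (integrable_isol μ k r).integrableOn
          (integrable_const _) hC fun x hx => ?_
        -- The ball of radius r around any point of C contains all of C.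
        refine pow_le_pow_left₀ (sub_nonneg.2 measureReal_le_one) (sub_le_sub_left ?_ _) _
        refine measureReal_mono fun y hy => ?_
        rw [Metric.mem_closedBall]
        exact hdiam y hy x hx
    _ = μ.real C * (1 - μ.real C) ^ k := by
        rw [setIntegral_const, smul_eq_mul]
    _ ≤ 1 / k := mul_one_sub_pow_le measureReal_le_one hk

/-- Every cell contributes at most 1/k regardless of its mass, so no lower bound on the measure
enters; points of the exceptional set T are counted with probability 1. -/
lemma isolProb_le_of_cover {ι : Type*} {k : ℕ} (hk : 0 < k) {r : ℝ} {T : Set (E d)}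
    (hT : MeasurableSet T) (s : Finset ι) (C : ι → Set (E d)) (hC : ∀ i, MeasurableSet (C i))
    (hdiam : ∀ i, ∀ x ∈ C i, ∀ y ∈ C i, dist x y ≤ r) (hcover : ∀ x ∉ T, ∃ i ∈ s, x ∈ C i) :
    isolProb μ k r ≤ s.card / k + μ.real T := by
  set φ : E d → ℝ := fun x => (1 - μ.real (Metric.closedBall x r)) ^ k
  have hφ0 : ∀ x, 0 ≤ φ x := fun x => pow_nonneg (sub_nonneg.2 measureReal_le_one) k
  have hφ1 : ∀ x, φ x ≤ 1 := fun x =>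
    pow_le_one₀ (sub_nonneg.2 measureReal_le_one) (sub_le_self _ measureReal_nonneg)
  have hi : ∀ i, Integrable ((C i).indicator φ) μ := fun i => (integrable_isol μ k r).indicator (hC i)
  have hiT : Integrable (T.indicator fun _ => (1 : ℝ)) μ := (integrable_const _).indicator hT
  calc isolProb μ k r ≤ ∫ x, (∑ i ∈ s, (C i).indicator φ x + T.indicator (fun _ => (1 : ℝ)) x) ∂μ := by
        refine integral_mono (integrable_isol μ k r)
          ((integrable_finsetSum _ fun i _ => hi i).add hiT) fun x => ?_
        have hs : ∀ i ∈ s, 0 ≤ (C i).indicator φ x := fun i _ =>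
          Set.indicator_nonneg (fun y _ => hφ0 y) x
        by_cases hx : x ∈ T
        · simp only [Set.indicator_of_mem hx]
          linarith [Finset.sum_nonneg hs, hφ1 x]
        · obtain ⟨i, his, hxi⟩ := hcover x hx
          simp only [Set.indicator_of_notMem hx, add_zero]
          have := Finset.single_le_sum hs his
          rwa [Set.indicator_of_mem hxi] at this
    _ = ∑ i ∈ s, ∫ x in C i, φ x ∂μ + μ.real T := by
        rw [integral_add (integrable_finsetSum _ fun i _ => hi i) hiT,
          integral_finsetSum _ fun i _ => hi i, integral_indicator_const _ hT]
        simp [integral_indicator (hC _)]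
    _ ≤ ∑ i ∈ s, (1 / k : ℝ) + μ.real T := by
        gcongr with i
        exact setIntegral_isol_le μ hk (hC i) (hdiam i)
    _ = s.card / k + μ.real T := by
        rw [Finset.sum_const, nsmul_eq_mul, mul_one_div]

/-- A packing bound for the probability that a sample point is isolated. -/
lemma isolProb_le_packing (hd : 0 < d) {k : ℕ} (hk : 0 < k) {r l : ℝ} (hr : 0 < r) (hr1 : r ≤ 1)
    (hl : 1 ≤ l) :
    isolProb μ k r ≤ ((2 * d + 3) * l) ^ d / (k * r ^ d) + μ.real {x | l < ‖x‖} := by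
  have hd' : (0 : ℝ) < d := by exact_mod_cast hd
  have hk' : (0 : ℝ) < k := by exact_mod_cast hk
  -- Cubes of side r/d have diameter at most r.
  have hh : 0 < r / d := div_pos hr hd'
  refine (isolProb_le_of_cover μ hk (measurableSet_lt measurable_const measurable_norm)
    (gridIndex d ⌈l / (r / d)⌉₊) (gridCell (r / d)) (measurableSet_gridCell _)
    (fun z x hx y hy => ?_) fun x hx => exists_mem_gridCell hh (not_lt.1 hx)).trans ?_
  · have := dist_le_of_mem_gridCell hh hx hy
    rwa [mul_div_cancel₀ _ hd'.ne'] at this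
  · refine add_le_add ?_ le_rfl
    rw [card_gridIndex, div_le_div_iff₀ hk' (by positivity)]
    have h1 : (⌈l / (r / d)⌉₊ : ℝ) < l / (r / d) + 1 := Nat.ceil_lt_add_one (by positivity)
    -- The left side is at most 2dl + 3r, and r ≤ 1 ≤ l.
    have h2 : (2 * (⌈l / (r / d)⌉₊ : ℝ) + 1) * r ≤ (2 * d + 3) * l := by
      have h3 : l / (r / d) * r = l * d := by field_simp
      nlinarith
    have h4 := pow_le_pow_left₀ (by positivity) h2 d
    rw [mul_pow] at h4
    push_cast
    nlinarith

/-- Two points more than r apart cannot both have norm at most r/2; one of the k other points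
suffices. This serves large radii. -/
lemma isolProb_le_two_mul_tail {k : ℕ} (hk : 0 < k) (r : ℝ) :
    isolProb μ k r ≤ 2 * μ.real {x | r / 2 < ‖x‖} := by
  have hT : MeasurableSet {x : E d | r / 2 < ‖x‖} :=
    measurableSet_lt measurable_const measurable_norm
  have hiT : Integrable ({x : E d | r / 2 < ‖x‖}.indicator fun _ => (1 : ℝ)) μ :=
    (integrable_const _).indicator hT
  calc isolProb μ k r ≤ ∫ x, ({x : E d | r / 2 < ‖x‖}.indicator (fun _ => (1 : ℝ)) x
        + μ.real {x | r / 2 < ‖x‖}) ∂μ := by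
        refine integral_mono (integrable_isol μ k r) (hiT.add (integrable_const _)) fun x => ?_
        have h0 : 0 ≤ 1 - μ.real (Metric.closedBall x r) := sub_nonneg.2 measureReal_le_one
        have h1 : 1 - μ.real (Metric.closedBall x r) ≤ 1 := sub_le_self _ measureReal_nonneg
        by_cases hx : r / 2 < ‖x‖
        · simp only [Set.indicator_of_mem (show x ∈ {x : E d | r / 2 < ‖x‖} from hx)]
          linarith [pow_le_one₀ (n := k) h0 h1,
            measureReal_nonneg (μ := μ) (s := {x : E d | r / 2 < ‖x‖})]
        · simp only [Set.indicator_of_notMem (show x ∉ {x : E d | r / 2 < ‖x‖} from hx), zero_add]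
          refine (pow_le_of_le_one h0 h1 hk.ne').trans ?_
          rw [← probReal_compl_eq_one_sub Metric.isClosed_closedBall.measurableSet]
          refine measureReal_mono fun y hy => ?_
          rw [compl_closedBall_eq] at hy
          have hy' : r < dist x y := hy
          show r / 2 < ‖y‖
          have := dist_le_norm_add_norm x y
          linarith [not_lt.1 hx]
    _ = _ := by
        rw [integral_add hiT (integrable_const _), integral_indicator_const _ hT]
        simp
        ring

lemma radius_mono (d k : ℕ) {s t : ℝ} (h : s ≤ t) : radius d k s ≤ radius d k t := by
  unfold radius
  gcongr

/-- An upper tail bound for the rescaled nearest neighbour distance, uniform in the sample size. -/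
lemma isolProb_radius_le (hd : 0 < d) {k : ℕ} (hk : 0 < k)
    (hσ : 0 ≤ Real.log k + Real.log (unitBallVolume d)) {s : ℝ} (hs : 0 ≤ s) :
    isolProb μ k (radius d k s)
      ≤ (2 * d + 3) ^ d * unitBallVolume d * Real.exp (-(s / 4))
        + 2 * μ.real {x | Real.exp (s / (4 * d)) / 2 < ‖x‖} := by
  have hd' : (0 : ℝ) < d := by exact_mod_cast hd
  have hk' : (0 : ℝ) < k := by exact_mod_cast hk
  have hV := unitBallVolume_pos d
  set σ := Real.log k + Real.log (unitBallVolume d) with hσdef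
  set C := (2 * (d : ℝ) + 3) ^ d * unitBallVolume d with hC
  have hC0 : 0 ≤ C := by positivity
  have tail_mono : ∀ {a b : ℝ}, a ≤ b → μ.real {x : E d | b < ‖x‖} ≤ μ.real {x | a < ‖x‖} :=
    fun hab => measureReal_mono fun x hx => hab.trans_lt hx
  have tail_nonneg : ∀ a : ℝ, 0 ≤ μ.real {x : E d | a < ‖x‖} := fun a => measureReal_nonneg
  have hrad : ∀ t, radius d k t = Real.exp ((t - σ) / d) := fun t => by
    rw [radius, hσdef, sub_sub]
  -- For t ≤ σ the radius is at most 1 and the packing bound applies. The choice l = e^{t/(2d)}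
  -- gives l^d = e^{t/2} against k r^d = e^t/V_d, hence decay e^{-t/2}.
  have small : ∀ t, 0 ≤ t → t ≤ σ → isolProb μ k (radius d k t)
      ≤ C * Real.exp (-(t / 2)) + μ.real {x | Real.exp (t / (2 * d)) < ‖x‖} := by
    intro t ht0 htσ
    have h1 : radius d k t ≤ 1 := by
      rw [hrad]
      exact Real.exp_le_one_iff.2 (div_nonpos_of_nonpos_of_nonneg (by linarith) hd'.le)
    refine (isolProb_le_packing μ hd hk (radius_pos d k t) h1
      (Real.one_le_exp (by positivity : 0 ≤ t / (2 * d)))).trans (add_le_add ?_ le_rfl)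
    refine le_of_eq ?_
    have h2 : (k : ℝ) * radius d k t ^ d = Real.exp t / unitBallVolume d := by
      rw [eq_div_iff hV.ne', mul_assoc, radius_pow_mul hd hk]
    have h3 : Real.exp (t / (2 * d)) ^ d = Real.exp (t / 2) := by
      rw [← Real.exp_nat_mul]
      congr 1
      field_simp
    rw [h2, mul_pow, h3, hC, show -(t / 2) = t / 2 - t by ring, Real.exp_sub]
    field_simp
  rcases le_total s (2 * σ) with h | h
  -- Monotonicity in the radius allows t = min(s, σ) in place of s; as s ≤ 2t, this only halves the
  -- exponents.
  · have key : ∀ t, 0 ≤ t → t ≤ σ → t ≤ s → s ≤ 2 * t → isolProb μ k (radius d k s)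
        ≤ C * Real.exp (-(s / 4)) + 2 * μ.real {x | Real.exp (s / (4 * d)) / 2 < ‖x‖} := by
      intro t ht0 htσ hts hst
      refine (isolProb_antitone μ k (radius_mono d k hts)).trans
        ((small t ht0 htσ).trans (add_le_add ?_ ?_))
      · exact mul_le_mul_of_nonneg_left (Real.exp_le_exp.2 (by linarith)) hC0
      · have h4 : s / (4 * d) ≤ t / (2 * d) := by
          rw [div_le_div_iff₀ (by positivity) (by positivity)]
          nlinarith
        have h5 : Real.exp (s / (4 * d)) / 2 ≤ Real.exp (t / (2 * d)) := by
          have := Real.exp_le_exp.2 h4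
          linarith [Real.exp_pos (s / (4 * d))]
        linarith [tail_mono h5, tail_nonneg (Real.exp (s / (4 * d)) / 2)]
    rcases le_total s σ with h' | h'
    · exact key s hs h' le_rfl (by linarith)
    · exact key σ hσ le_rfl h' h
  -- For s ≥ 2σ the radius e^{(s-σ)/d} is itself at least e^{s/(4d)}.
  · refine (isolProb_le_two_mul_tail μ hk _).trans ?_
    have h4 : s / (4 * d) ≤ (s - σ) / d := by
      rw [div_le_div_iff₀ (by positivity) (by positivity)]
      nlinarith
    have h5 := tail_mono (show Real.exp (s / (4 * d)) / 2 ≤ radius d k s / 2 by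
      rw [hrad]
      exact div_le_div_of_nonneg_right (Real.exp_le_exp.2 h4) two_pos.le)
    have := mul_nonneg hC0 (Real.exp_pos (-(s / 4))).le
    linarith

end Isol

/-! ### Small nearest neighbour distances -/

variable {d : ℕ} {f : E d → ℝ}

lemma law_closedBall_zero (hd : 0 < d) (f : E d → ℝ) (x : E d) :
    law f (Metric.closedBall x 0) = 0 := by
  refine law_absolutelyContinuous f ?_
  rw [volume_closedBall_eq hd x le_rfl]
  simp [hd.ne']

lemma IsProbDensity.ae_nearestDist_pos (hd : 0 < d) (hf : IsProbDensity f) (n : ℕ) :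
    ∀ᵐ x ∂sampleLaw (law f) (n + 2), ∀ i, 0 < nearestDist x i := by
  have := hf.isProbabilityMeasure_law
  rw [ae_all_iff]
  intro i
  have h : sampleLaw (law f) (n + 2) {x | 0 < nearestDist x i} = 1 := by
    simp_rw [sampleLaw_lt_nearestDist, prob_compl_eq_one_sub
      Metric.isClosed_closedBall.measurableSet, law_closedBall_zero hd f]
    simp
  exact (mem_ae_iff_prob_eq_one (measurableSet_lt_nearestDist i 0)).2 h

/-- Bernoulli's inequality bounds the left side by min(kp, 1), which is at most (kp)^ε for 0 < ε ≤
1. -/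
lemma one_sub_one_sub_pow_le {p ε : ℝ} (hp : 0 ≤ p) (hp1 : p ≤ 1) (hε : 0 < ε) (hε1 : ε ≤ 1)
    (k : ℕ) : 1 - (1 - p) ^ k ≤ (k * p) ^ ε := by
  have h0 : 0 ≤ (1 - p) ^ k := pow_nonneg (by linarith) k
  have hkp : 0 ≤ k * p := by positivity
  rcases le_total (k * p) 1 with h | h
  · have h1 : k * p ≤ (k * p) ^ ε := by
      rcases hkp.eq_or_lt with h2 | h2
      · rw [← h2, Real.zero_rpow hε.ne']
      · exact Real.self_le_rpow_of_le_one hkp h hε1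
    have h2 := one_add_mul_le_pow (a := -p) (by linarith) k
    rw [← sub_eq_add_neg] at h2
    linarith
  · have := Real.one_le_rpow h hε.le
    linarith

/-- A lower tail bound for the rescaled nearest neighbour distance. -/
lemma IsProbDensity.sampleLaw_nearestDist_le (hd : 0 < d) (hf : IsProbDensity f)
    {ε R : ℝ} (hε : 0 < ε) (hε1 : ε ≤ 1) (n : ℕ) (i : Fin (n + 2)) {s : ℝ}
    (hR : radius d (n + 1) (-s) ≤ R) :
    sampleLaw (law f) (n + 2) {x | nearestDist x i ≤ radius d (n + 1) (-s)}
      ≤ Q f ε R * ENNReal.ofReal (Real.exp (-(ε * s))) := by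
  have := hf.isProbabilityMeasure_law
  set r := radius d (n + 1) (-s) with hr
  have hr0 : 0 < r := radius_pos _ _ _
  have hset : {x : Fin (n + 2) → E d | nearestDist x i ≤ r} = {x | r < nearestDist x i}ᶜ := by
    ext x
    simp
  have hint := (integrable_const (μ := law f) (1 : ℝ)).sub (integrable_isol (law f) (n + 1) r)
  have h1 : (sampleLaw (law f) (n + 2)).real {x | nearestDist x i ≤ r}
      = ∫ x, (1 - (1 - (law f).real (Metric.closedBall x r)) ^ (n + 1)) ∂law f := by
    rw [hset, probReal_compl_eq_one_sub (measurableSet_lt_nearestDist i r),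
      sampleLaw_real_lt_nearestDist, isolProb, integral_sub (integrable_const _)
      (integrable_isol _ _ _)]
    simp
  rw [← ENNReal.ofReal_toReal (measure_ne_top (sampleLaw (law f) (n + 2)) _), ← measureReal_def, h1,
    ofReal_integral_eq_lintegral_ofReal (by exact hint) (ae_of_all _ fun x => sub_nonneg.2
      (pow_le_one₀ (sub_nonneg.2 measureReal_le_one) (sub_le_self _ measureReal_nonneg))),
    Q, ← hf.lintegral_law, ← lintegral_mul_const' _ _ ENNReal.ofReal_ne_top]
  refine lintegral_mono fun x => ?_
  -- The expected number of neighbours in the ball is its mean density times e^{-s}, by the choice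
  -- of the radius.
  have h2 : ENNReal.ofReal (((n + 1 : ℕ) : ℝ) * (law f).real (Metric.closedBall x r))
      = ballMean f x r * ENNReal.ofReal (Real.exp (-s)) := by
    rw [ENNReal.ofReal_mul (Nat.cast_nonneg _), measureReal_def,
      ENNReal.ofReal_toReal (measure_ne_top _ _), law_closedBall_eq_ballMean f x hr0,
      mul_left_comm, ← ENNReal.ofReal_mul (Nat.cast_nonneg _), hr,
      radius_pow_mul hd (Nat.succ_pos n)]
  calc ENNReal.ofReal (1 - (1 - (law f).real (Metric.closedBall x r)) ^ (n + 1))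
      ≤ ENNReal.ofReal ((((n + 1 : ℕ) : ℝ) * (law f).real (Metric.closedBall x r)) ^ ε) :=
        ENNReal.ofReal_le_ofReal (one_sub_one_sub_pow_le measureReal_nonneg measureReal_le_one
          hε hε1 (n + 1))
    _ = ballMean f x r ^ ε * ENNReal.ofReal (Real.exp (-(ε * s))) := by
        rw [← ENNReal.ofReal_rpow_of_nonneg (by positivity) hε.le, h2,
          ENNReal.mul_rpow_of_nonneg _ _ hε.le, ENNReal.ofReal_rpow_of_pos (Real.exp_pos _),
          ← Real.exp_mul]
        congr 3
        ring
    _ ≤ supMean f x R ^ ε * ENNReal.ofReal (Real.exp (-(ε * s))) := by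
        gcongr
        exact le_iSup₂ (f := fun r (_ : r ∈ Set.Ioc (0 : ℝ) R) => ballMean f x r) r ⟨hr0, hR⟩

end KozachenkoLeonenko

end

noncomputable section

namespace KozachenkoLeonenko

/-! ### Uniform integrability -/

variable {d : ℕ} {f : E d → ℝ}

/-- A tail with a finite second moment bounds the truncation error uniformly. -/
lemma lintegral_sub_clamp_sq_le {α : Type*} [MeasurableSpace α] (π : Measure α) {Y : α → ℝ}
    (hY : Measurable Y) {Ψ : ℝ → ℝ≥0∞} (hΨ : ∀ s, 0 ≤ s → π {a | s < |Y a|} ≤ Ψ s) {A : ℝ}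
    (hA : 0 ≤ A) :
    ∫⁻ a, ENNReal.ofReal ((Y a - clamp A (Y a)) ^ 2) ∂π
      ≤ 2 * ∫⁻ t in Set.Ioi (0 : ℝ), Ψ (A + t) * ENNReal.ofReal t := by
  -- E Z² = 2 ∫ t P(Z > t) dt for the truncation error Z, which exceeds t > 0 only if |Y| > A + t.
  have h := lintegral_rpow_eq_lintegral_meas_lt_mul π (f := fun a => |Y a - clamp A (Y a)|)
    (ae_of_all _ fun a => abs_nonneg _)
    (hY.sub ((continuous_clamp A).measurable.comp hY)).abs.aemeasurable two_pos
  simp only [Real.rpow_two, sq_abs] at h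
  rw [h, ENNReal.ofReal_ofNat]
  gcongr 2 * ?_
  refine setLIntegral_mono' measurableSet_Ioi fun t ht => ?_
  have ht' : (0 : ℝ) < t := ht
  have h1 : (2 : ℝ) - 1 = 1 := by norm_num
  rw [h1, Real.rpow_one]
  gcongr
  refine (measure_mono fun a ha => ?_).trans (hΨ (A + t) (by linarith))
  have ha' : t < |Y a - clamp A (Y a)| := ha
  rw [abs_sub_clamp hA] at ha'
  show A + t < |Y a|
  rcases lt_max_iff.1 ha' with h2 | h2
  · linarith
  · linarith

lemma tendsto_lintegral_shift_mul {Ψ : ℝ → ℝ≥0∞} (hanti : Antitone Ψ)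
    (hlim : Tendsto Ψ atTop (𝓝 0))
    (hfin : ∫⁻ t in Set.Ioi (0 : ℝ), Ψ t * ENNReal.ofReal t < ∞) :
    Tendsto (fun A : ℝ => 2 * ∫⁻ t in Set.Ioi (0 : ℝ), Ψ (A + t) * ENNReal.ofReal t) atTop
      (𝓝 0) := by
  have h : Tendsto (fun A : ℝ => ∫⁻ t in Set.Ioi (0 : ℝ), Ψ (A + t) * ENNReal.ofReal t) atTop
      (𝓝 (∫⁻ _t in Set.Ioi (0 : ℝ), 0)) := by
    refine tendsto_lintegral_filter_of_dominated_convergence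
      (fun t => Ψ t * ENNReal.ofReal t) (Eventually.of_forall fun A => ?_) ?_ hfin.ne
      (ae_of_all _ fun t => ?_)
    · exact (hanti.measurable.comp (measurable_const_add A)).mul ENNReal.measurable_ofReal
    · filter_upwards [eventually_ge_atTop 0] with A hA
      refine ae_of_all _ fun t => ?_
      gcongr
      exact hanti (by linarith)
    · have h1 := ENNReal.Tendsto.mul_const (b := ENNReal.ofReal t)
        (hlim.comp (tendsto_atTop_add_const_right atTop t tendsto_id))
        (Or.inr ENNReal.ofReal_ne_top)
      rw [zero_mul] at h1
      exact h1
  rw [lintegral_zero] at h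
  have h2 := ENNReal.Tendsto.const_mul (a := 2) h (Or.inr ENNReal.ofNat_ne_top)
  rwa [mul_zero] at h2

lemma lintegral_exp_neg_mul_lt_top {a : ℝ} (ha : 0 < a) :
    ∫⁻ t in Set.Ioi (0 : ℝ), ENNReal.ofReal (Real.exp (-(a * t))) * ENNReal.ofReal t < ∞ := by
  have h := integrableOn_rpow_mul_exp_neg_mul_rpow (s := 1) (p := 1) (b := a) (by norm_num)
    one_pos ha
  have h2 := h.2
  rw [hasFiniteIntegral_iff_ofReal] at h2
  · refine lt_of_eq_of_lt (setLIntegral_congr_fun measurableSet_Ioi fun t ht => ?_) h2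
    have ht' : (0 : ℝ) < t := ht
    rw [← ENNReal.ofReal_mul (Real.exp_pos _).le]
    congr 1
    rw [Real.rpow_one, mul_comm, neg_mul]
  · filter_upwards [ae_restrict_mem measurableSet_Ioi] with t ht
    have ht' : (0 : ℝ) < t := ht
    positivity

/-- A bound of the tails of the logarithms of the rescaled nearest neighbour distances. -/
def tailBound (f : E d → ℝ) (C ε : ℝ) (D : ℝ≥0∞) (s : ℝ) : ℝ≥0∞ :=
  ENNReal.ofReal C * ENNReal.ofReal (Real.exp (-(1 / 4 * s)))
    + 2 * law f {x | s < 4 * d * (Real.log 2 + Real.log (1 + ‖x‖))}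
    + D * ENNReal.ofReal (Real.exp (-(ε * s)))

lemma antitone_tailBound (C : ℝ) {ε : ℝ} (hε : 0 < ε) (D : ℝ≥0∞) :
    Antitone (tailBound f C ε D) := by
  intro s t hst
  unfold tailBound
  gcongr

lemma tendsto_tailBound (hf : IsProbDensity f) (C : ℝ) {ε : ℝ} (hε : 0 < ε) {D : ℝ≥0∞}
    (hD : D ≠ ∞) : Tendsto (tailBound f C ε D) atTop (𝓝 0) := by
  have := hf.isProbabilityMeasure_law
  have hexp : ∀ a : ℝ, 0 < a →
      Tendsto (fun s : ℝ => ENNReal.ofReal (Real.exp (-(a * s)))) atTop (𝓝 0) := fun a ha => by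
    have h1 : Tendsto (fun s : ℝ => Real.exp (-(a * s))) atTop (𝓝 0) :=
      Real.tendsto_exp_neg_atTop_nhds_zero.comp (tendsto_id.const_mul_atTop ha)
    simpa using ENNReal.tendsto_ofReal h1
  have htail : Tendsto (fun s : ℝ => law f {x | s < 4 * d * (Real.log 2 + Real.log (1 + ‖x‖))})
      atTop (𝓝 0) := by
    have hanti : Antitone fun s : ℝ => {x : E d | s < 4 * d * (Real.log 2 + Real.log (1 + ‖x‖))} :=
      fun s t hst x hx => lt_of_le_of_lt hst hx
    have hm : ∀ s : ℝ, NullMeasurableSet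
        {x : E d | s < 4 * d * (Real.log 2 + Real.log (1 + ‖x‖))} (law f) := fun s =>
      (measurableSet_lt measurable_const (by fun_prop)).nullMeasurableSet
    have h := tendsto_measure_iInter_atTop (μ := law f) hm hanti ⟨0, measure_ne_top _ _⟩
    have hemp : ⋂ s : ℝ, {x : E d | s < 4 * d * (Real.log 2 + Real.log (1 + ‖x‖))} = ∅ := by
      refine Set.eq_empty_of_forall_notMem fun x hx => ?_
      have h1 : 4 * d * (Real.log 2 + Real.log (1 + ‖x‖))
          < 4 * d * (Real.log 2 + Real.log (1 + ‖x‖)) := Set.mem_iInter.1 hx _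
      exact lt_irrefl _ h1
    rwa [hemp, measure_empty] at h
  have h := ((ENNReal.Tendsto.const_mul (a := ENNReal.ofReal C) (hexp (1 / 4) (by norm_num))
      (Or.inr ENNReal.ofReal_ne_top)).add
    (ENNReal.Tendsto.const_mul (a := 2) htail (Or.inr ENNReal.ofNat_ne_top))).add
    (ENNReal.Tendsto.const_mul (a := D) (hexp ε hε) (Or.inr hD))
  simp only [mul_zero, add_zero] at h
  exact h

lemma lintegral_tailBound_lt_top (hf : IsProbDensity f) (hlog : HasLogSqMoment f) (C : ℝ) {ε : ℝ}
    (hε : 0 < ε) {D : ℝ≥0∞} (hD : D ≠ ∞) :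
    ∫⁻ t in Set.Ioi (0 : ℝ), tailBound f C ε D t * ENNReal.ofReal t < ∞ := by
  have := hf.isProbabilityMeasure_law
  have hm : Measurable fun x : E d => 4 * d * (Real.log 2 + Real.log (1 + ‖x‖)) := by fun_prop
  have h0 : ∀ x : E d, 0 ≤ 4 * d * (Real.log 2 + Real.log (1 + ‖x‖)) := fun x =>
    mul_nonneg (by positivity) (add_nonneg (Real.log_nonneg one_le_two)
      (Real.log_nonneg (by linarith [norm_nonneg x])))
  -- Twice this integral is the second moment of 4d(log 2 + log(1 + ‖X‖)); here the second
  -- logarithmic moment enters.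
  have htail : ∫⁻ t in Set.Ioi (0 : ℝ),
      law f {x | t < 4 * d * (Real.log 2 + Real.log (1 + ‖x‖))} * ENNReal.ofReal t < ∞ := by
    have h := lintegral_rpow_eq_lintegral_meas_lt_mul (law f) (ae_of_all _ h0) hm.aemeasurable
      two_pos
    have h1 : (2 : ℝ) - 1 = 1 := by norm_num
    simp only [Real.rpow_two, h1, Real.rpow_one, ENNReal.ofReal_ofNat] at h
    have hle : ∀ x : E d, ENNReal.ofReal ((4 * d * (Real.log 2 + Real.log (1 + ‖x‖))) ^ 2)
        ≤ ENNReal.ofReal (32 * d ^ 2 * Real.log 2 ^ 2)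
          + ENNReal.ofReal (32 * d ^ 2) * ENNReal.ofReal (Real.log (1 + ‖x‖) ^ 2) := fun x => by
      rw [← ENNReal.ofReal_mul (by positivity)]
      refine le_trans (ENNReal.ofReal_le_ofReal ?_) ENNReal.ofReal_add_le
      have := mul_nonneg (sq_nonneg (4 * (d : ℝ)))
        (sq_nonneg (Real.log 2 - Real.log (1 + ‖x‖)))
      linarith
    have hfin : ∫⁻ x, ENNReal.ofReal ((4 * d * (Real.log 2 + Real.log (1 + ‖x‖))) ^ 2) ∂law f
        < ∞ := by
      refine (lintegral_mono hle).trans_lt ?_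
      rw [lintegral_add_left measurable_const, lintegral_const_mul' _ _ ENNReal.ofReal_ne_top]
      refine ENNReal.add_lt_top.2 ⟨?_, ENNReal.mul_lt_top ENNReal.ofReal_lt_top hlog⟩
      rw [lintegral_const, measure_univ, mul_one]
      exact ENNReal.ofReal_lt_top
    rw [h] at hfin
    exact ENNReal.lt_top_of_mul_ne_top_right hfin.ne two_ne_zero
  have hE : ∀ a : ℝ, Measurable fun t : ℝ => ENNReal.ofReal (Real.exp (-(a * t))) *
      ENNReal.ofReal t := fun a => by fun_prop
  have hT : Measurable fun t : ℝ =>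
      law f {x | t < 4 * d * (Real.log 2 + Real.log (1 + ‖x‖))} * ENNReal.ofReal t := by
    refine Measurable.mul (Antitone.measurable fun s t hst => ?_) ENNReal.measurable_ofReal
    exact measure_mono fun x hx => lt_of_le_of_lt hst hx
  have hsplit : ∀ t : ℝ, tailBound f C ε D t * ENNReal.ofReal t
      = ENNReal.ofReal C * (ENNReal.ofReal (Real.exp (-(1 / 4 * t))) * ENNReal.ofReal t)
        + (2 * (law f {x | t < 4 * d * (Real.log 2 + Real.log (1 + ‖x‖))} * ENNReal.ofReal t)
        + D * (ENNReal.ofReal (Real.exp (-(ε * t))) * ENNReal.ofReal t)) := fun t => by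
    unfold tailBound
    ring
  simp_rw [hsplit]
  rw [lintegral_add_left ((hE _).const_mul _), lintegral_add_left (hT.const_mul _),
    lintegral_const_mul' _ _ ENNReal.ofReal_ne_top, lintegral_const_mul' _ _ ENNReal.ofNat_ne_top,
    lintegral_const_mul' _ _ hD]
  refine ENNReal.add_lt_top.2 ⟨ENNReal.mul_lt_top ENNReal.ofReal_lt_top
    (lintegral_exp_neg_mul_lt_top (by norm_num)), ENNReal.add_lt_top.2
    ⟨ENNReal.mul_lt_top ENNReal.ofNat_lt_top htail,
      ENNReal.mul_lt_top hD.lt_top (lintegral_exp_neg_mul_lt_top hε)⟩⟩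

/-- The logarithms of the rescaled nearest neighbour distances have uniformly bounded tails. -/
lemma IsProbDensity.sampleLaw_lt_abs_logSpacing_le (hd : 0 < d) (hf : IsProbDensity f)
    {ε R : ℝ} (hε : 0 < ε) (hε1 : ε ≤ 1) {n : ℕ} (hR : radius d (n + 1) 0 ≤ R)
    (hσ : 0 ≤ Real.log (n + 1 : ℕ) + Real.log (unitBallVolume d)) (i : Fin (n + 2)) {s : ℝ}
    (hs : 0 ≤ s) :
    sampleLaw (law f) (n + 2) {x | s < |logSpacing x i|}
      ≤ tailBound f ((2 * d + 3) ^ d * unitBallVolume d) ε (Q f ε R) s := by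
  have := hf.isProbabilityMeasure_law
  have hd' : (0 : ℝ) < d := by exact_mod_cast hd
  set π := sampleLaw (law f) (n + 2)
  have h1 : π {x | s < |logSpacing x i|}
      ≤ π {x | radius d (n + 1) s < nearestDist x i}
        + π {x | nearestDist x i ≤ radius d (n + 1) (-s)} := by
    refine (measure_mono_ae ?_).trans (measure_union_le _ _)
    filter_upwards [hf.ae_nearestDist_pos hd n] with x hx hsx
    have hsx' : s < |logSpacing x i| := hsx
    rcases lt_abs.1 hsx' with h | h
    · exact Or.inl ((radius_lt_nearestDist_iff hd x i (hx i) s).2 h)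
    · refine Or.inr ?_
      show nearestDist x i ≤ radius d (n + 1) (-s)
      refine not_lt.1 fun h2 => ?_
      have := (radius_lt_nearestDist_iff hd x i (hx i) (-s)).1 h2
      linarith
  refine h1.trans (add_le_add ?_ (hf.sampleLaw_nearestDist_le hd hε hε1 n i
    ((radius_mono d (n + 1) (by linarith)).trans hR)))
  have h2 := isolProb_radius_le (law f) hd (Nat.succ_pos n) hσ hs
  rw [← sampleLaw_real_lt_nearestDist (law f) n i] at h2
  rw [← ENNReal.ofReal_toReal (measure_ne_top π _), ← measureReal_def]
  refine (ENNReal.ofReal_le_ofReal h2).trans (ENNReal.ofReal_add_le.trans (add_le_add ?_ ?_))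
  · rw [ENNReal.ofReal_mul (mul_nonneg (by positivity) (unitBallVolume_pos d).le)]
    rw [show s / 4 = 1 / 4 * s by ring]
  · rw [ENNReal.ofReal_mul two_pos.le, ENNReal.ofReal_ofNat, measureReal_def,
      ENNReal.ofReal_toReal (measure_ne_top _ _)]
    gcongr 2 * ?_
    refine measure_mono fun x hx => ?_
    have hx' : Real.exp (s / (4 * d)) / 2 < ‖x‖ := hx
    have h3 : Real.exp (s / (4 * d)) < 2 * (1 + ‖x‖) := by linarith
    have h4 := (Real.lt_log_iff_exp_lt (by positivity)).2 h3
    rw [Real.log_mul two_ne_zero (by positivity), div_lt_iff₀ (by positivity)] at h4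
    show s < 4 * d * (Real.log 2 + Real.log (1 + ‖x‖))
    linarith

/-! ### The Kozachenko - Leonenko estimate -/

lemma klEstimate_eq {n : ℕ} (x : Fin (n + 2) → E d) (h : ∀ i, 0 < nearestDist x i) :
    klEstimate x = (∑ i, logSpacing x i) / (n + 2 : ℕ) + eulerConstant := by
  have hcast : ((n + 2 : ℕ) : ℝ) - 1 = (n + 1 : ℕ) := by push_cast; ring
  rw [klEstimate, hcast, Real.log_rpow (Finset.prod_pos fun i _ => h i),
    Real.log_prod fun i _ => (h i).ne']
  simp only [logSpacing, Finset.sum_add_distrib, Finset.sum_const, Finset.card_univ,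
    Fintype.card_fin, nsmul_eq_mul, ← Finset.mul_sum]
  have : ((n + 2 : ℕ) : ℝ) ≠ 0 := by positivity
  field_simp
  ring

lemma measurable_klEstimate {N : ℕ} : Measurable (klEstimate : (Fin N → E d) → ℝ) := by
  unfold klEstimate
  have h : Measurable fun x : Fin N → E d => ∏ i, nearestDist x i :=
    Finset.measurable_fun_prod _ fun i _ => measurable_nearestDist i
  fun_prop

lemma sq_sum_div_le {N : ℕ} (a : Fin N → ℝ) : ((∑ i, a i) / N) ^ 2 ≤ (∑ i, a i ^ 2) / N := by
  rcases Nat.eq_zero_or_pos N with rfl | hN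
  · simp
  have h := sq_sum_le_card_mul_sum_sq (s := Finset.univ) (f := a)
  rw [Finset.card_univ, Fintype.card_fin] at h
  have hN' : (0 : ℝ) < N := by exact_mod_cast hN
  rw [div_pow, div_le_div_iff₀ (by positivity) hN']
  nlinarith

/-- The truncation error of the mean of the logarithms. -/
lemma lintegral_mean_sub_clamp_sq_le (μ : Measure (E d)) {n : ℕ} {A : ℝ}
    {δ : ℝ≥0∞} (h : ∀ i, ∫⁻ x, ENNReal.ofReal ((logSpacing x i - clamp A (logSpacing x i)) ^ 2)
      ∂sampleLaw μ (n + 2) ≤ δ) :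
    ∫⁻ x, ENNReal.ofReal (((∑ i, logSpacing x i) / (n + 2 : ℕ)
        - (∑ i, clamp A (logSpacing x i)) / (n + 2 : ℕ)) ^ 2) ∂sampleLaw μ (n + 2) ≤ δ := by
  have hm : ∀ i, Measurable fun x : Fin (n + 2) → E d =>
      ENNReal.ofReal ((logSpacing x i - clamp A (logSpacing x i)) ^ 2) := fun i =>
    (((measurable_logSpacing i).sub ((continuous_clamp A).measurable.comp
      (measurable_logSpacing i))).pow_const 2).ennreal_ofReal
  have hN : (0 : ℝ) < (n + 2 : ℕ) := by positivity
  calc _ ≤ ∫⁻ x, (∑ i, ENNReal.ofReal ((logSpacing x i - clamp A (logSpacing x i)) ^ 2))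
          / ((n + 2 : ℕ) : ℝ≥0∞) ∂sampleLaw μ (n + 2) := by
        refine lintegral_mono fun x => ?_
        rw [← sub_div, ← Finset.sum_sub_distrib]
        refine (ENNReal.ofReal_le_ofReal (sq_sum_div_le _)).trans_eq ?_
        rw [ENNReal.ofReal_div_of_pos hN, ENNReal.ofReal_sum_of_nonneg fun i _ => sq_nonneg _,
          ENNReal.ofReal_natCast]
    _ = (∑ i, ∫⁻ x, ENNReal.ofReal ((logSpacing x i - clamp A (logSpacing x i)) ^ 2)
          ∂sampleLaw μ (n + 2)) / ((n + 2 : ℕ) : ℝ≥0∞) := by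
        simp_rw [div_eq_mul_inv]
        rw [lintegral_mul_const _ (Finset.measurable_fun_sum _ fun i _ => hm i),
          lintegral_finsetSum _ fun i _ => hm i]
    _ ≤ δ := by
        refine ENNReal.div_le_of_le_mul ?_
        refine (Finset.sum_le_sum fun i _ => h i).trans_eq ?_
        rw [Finset.sum_const, Finset.card_univ, Fintype.card_fin, nsmul_eq_mul, mul_comm]

/-- From (a + b + c)² ≤ 3(a² + b² + c²) for the truncation error, the fluctuation of the truncated
mean, and the bias of the truncated limit. -/
lemma IsProbDensity.lintegral_klEstimate_sub_sq_le (hd : 0 < d) (hf : IsProbDensity f) (n : ℕ)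
    {A : ℝ} {δ : ℝ≥0∞}
    (h : ∀ i, ∫⁻ x, ENNReal.ofReal ((logSpacing x i - clamp A (logSpacing x i)) ^ 2)
      ∂sampleLaw (law f) (n + 2) ≤ δ) :
    ∫⁻ x, ENNReal.ofReal ((klEstimate x - entropy f) ^ 2) ∂sampleLaw (law f) (n + 2)
      ≤ 3 * (δ + ENNReal.ofReal (∫ x, ((∑ i, clamp A (logSpacing x i)) / (n + 2 : ℕ)
          - clampLimit f A) ^ 2 ∂sampleLaw (law f) (n + 2))
        + ENNReal.ofReal ((clampLimit f A - (entropy f - eulerConstant)) ^ 2)) := by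
  have := hf.isProbabilityMeasure_law
  set π := sampleLaw (law f) (n + 2)
  set c := (clampLimit f A - (entropy f - eulerConstant)) ^ 2
  have hcm : ∀ i, Measurable fun x : Fin (n + 2) → E d => clamp A (logSpacing x i) := fun i =>
    (continuous_clamp A).measurable.comp (measurable_logSpacing i)
  set S : (Fin (n + 2) → E d) → ℝ := fun x => (∑ i, logSpacing x i) / (n + 2 : ℕ) with hS
  set SA : (Fin (n + 2) → E d) → ℝ := fun x => (∑ i, clamp A (logSpacing x i)) / (n + 2 : ℕ)
    with hSA
  have hSm : Measurable S :=
    (Finset.measurable_fun_sum _ fun i _ => measurable_logSpacing i).div_const _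
  have hSAm : Measurable SA := (Finset.measurable_fun_sum _ fun i _ => hcm i).div_const _
  have hclamp : ∀ t, |clamp A t| ≤ |A| := fun t => by
    unfold clamp
    rw [abs_le]
    constructor
    · exact (neg_le_neg (le_abs_self A)).trans (le_max_left _ _)
    · exact max_le (neg_le_abs A) ((min_le_right _ _).trans (le_abs_self A))
  have hint : Integrable (fun x => (SA x - clampLimit f A) ^ 2) π := by
    have hb : ∀ x, |SA x| ≤ |A| := fun x => by
      have hN : (0 : ℝ) < (n + 2 : ℕ) := by positivity
      rw [hSA, abs_div, abs_of_pos hN, div_le_iff₀ hN]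
      refine (Finset.abs_sum_le_sum_abs _ _).trans
        ((Finset.sum_le_sum fun i _ => hclamp _).trans_eq ?_)
      rw [Finset.sum_const, Finset.card_univ, Fintype.card_fin, nsmul_eq_mul, mul_comm]
    refine Integrable.of_bound ((hSAm.sub_const _).pow_const 2).aestronglyMeasurable
      ((|A| + |clampLimit f A|) ^ 2) (ae_of_all _ fun x => ?_)
    rw [Real.norm_of_nonneg (sq_nonneg _), ← sq_abs]
    exact pow_le_pow_left₀ (abs_nonneg _) ((abs_sub _ _).trans (by linarith [hb x])) 2
  calc ∫⁻ x, ENNReal.ofReal ((klEstimate x - entropy f) ^ 2) ∂π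
      ≤ ∫⁻ x, 3 * (ENNReal.ofReal ((S x - SA x) ^ 2)
          + ENNReal.ofReal ((SA x - clampLimit f A) ^ 2) + ENNReal.ofReal c) ∂π := by
        refine lintegral_mono_ae ?_
        filter_upwards [hf.ae_nearestDist_pos hd n] with x hx
        rw [← ENNReal.ofReal_add (sq_nonneg _) (sq_nonneg _),
          ← ENNReal.ofReal_add (add_nonneg (sq_nonneg _) (sq_nonneg _)) (sq_nonneg _),
          ← ENNReal.ofReal_ofNat 3, ← ENNReal.ofReal_mul (by norm_num)]
        refine ENNReal.ofReal_le_ofReal ?_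
        rw [klEstimate_eq x hx]
        have h1 : (∑ i, logSpacing x i) / (n + 2 : ℕ) + eulerConstant - entropy f
            = (S x - SA x) + (SA x - clampLimit f A)
              + (clampLimit f A - (entropy f - eulerConstant)) := by
          ring
        rw [h1]
        nlinarith [sq_nonneg ((S x - SA x) - (SA x - clampLimit f A)),
          sq_nonneg ((S x - SA x) - (clampLimit f A - (entropy f - eulerConstant))),
          sq_nonneg ((SA x - clampLimit f A) - (clampLimit f A - (entropy f - eulerConstant)))]
    _ = 3 * (∫⁻ x, ENNReal.ofReal ((S x - SA x) ^ 2) ∂π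
          + ∫⁻ x, ENNReal.ofReal ((SA x - clampLimit f A) ^ 2) ∂π + ENNReal.ofReal c) := by
        rw [lintegral_const_mul' _ _ ENNReal.ofNat_ne_top, lintegral_add_right _ measurable_const,
          lintegral_add_left (by exact ((hSm.sub hSAm).pow_const 2).ennreal_ofReal)]
        simp
    _ ≤ _ := by
        rw [← ofReal_integral_eq_lintegral_ofReal hint (ae_of_all _ fun x => sq_nonneg _)]
        gcongr
        exact lintegral_mean_sub_clamp_sq_le (law f) h

lemma IsProbDensity.tendsto_lintegral_klEstimate_sub_sq (hd : 0 < d) (hf : IsProbDensity f)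
    (hlog : HasLogSqMoment f) {ε R : ℝ} (hε : 0 < ε) (hε1 : ε ≤ 1) (hR : 0 < R)
    (hQ : Q f ε R < ∞) :
    Tendsto (fun n : ℕ => ∫⁻ x, ENNReal.ofReal ((klEstimate x - entropy f) ^ 2)
      ∂sampleLaw (law f) (n + 2)) atTop (𝓝 0) := by
  have hH := hf.hasFiniteEntropy hd hlog hε hR hQ
  set Ψ := tailBound f ((2 * d + 3) ^ d * unitBallVolume d) ε (Q f ε R) with hΨ
  set δ : ℝ → ℝ≥0∞ := fun A => 2 * ∫⁻ t in Set.Ioi (0 : ℝ), Ψ (A + t) * ENNReal.ofReal t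
  have hδ : Tendsto δ atTop (𝓝 0) := tendsto_lintegral_shift_mul (antitone_tailBound _ hε _)
    (tendsto_tailBound hf _ hε hQ.ne) (lintegral_tailBound_lt_top hf hlog _ hε hQ.ne)
  have hc : Tendsto (fun A => ENNReal.ofReal ((clampLimit f A - (entropy f - eulerConstant)) ^ 2))
      atTop (𝓝 0) := by
    have h1 := (((hf.tendsto_clampLimit hH).sub_const (entropy f - eulerConstant)).pow 2)
    simpa using ENNReal.tendsto_ofReal h1
  have hrad : ∀ᶠ n : ℕ in atTop, radius d (n + 1) 0 ≤ R := by
    have h1 := ((tendsto_radius hd 0).comp (tendsto_add_atTop_nat 1)).mono_right nhdsWithin_le_nhds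
    exact h1.eventually_le_const hR
  have hσ : ∀ᶠ n : ℕ in atTop, 0 ≤ Real.log (n + 1 : ℕ) + Real.log (unitBallVolume d) := by
    have h1 : Tendsto (fun n : ℕ => Real.log (n + 1 : ℕ) + Real.log (unitBallVolume d)) atTop
        atTop := tendsto_atTop_add_const_right _ _ (Real.tendsto_log_atTop.comp
          (tendsto_natCast_atTop_atTop.comp (tendsto_add_atTop_nat 1)))
    exact h1.eventually_ge_atTop 0
  rw [ENNReal.tendsto_nhds_zero]
  intro η hη
  have hlimA : Tendsto (fun A => 3 * (δ A + 0
      + ENNReal.ofReal ((clampLimit f A - (entropy f - eulerConstant)) ^ 2))) atTop (𝓝 0) := by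
    have h1 := ENNReal.Tendsto.const_mul (a := 3) ((hδ.add (tendsto_const_nhds (x := 0))).add hc)
      (Or.inr ENNReal.ofNat_ne_top)
    simpa using h1
  -- The truncation error δ A does not depend on n, so A is fixed first and n sent to infinity
  -- afterwards.
  obtain ⟨A, hAη, hA⟩ := ((hlimA.eventually_lt_const hη).and (eventually_ge_atTop 0)).exists
  have hlimn : Tendsto (fun n : ℕ => 3 * (δ A
      + ENNReal.ofReal (∫ x, ((∑ i, clamp A (logSpacing x i)) / (n + 2 : ℕ)
          - clampLimit f A) ^ 2 ∂sampleLaw (law f) (n + 2))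
      + ENNReal.ofReal ((clampLimit f A - (entropy f - eulerConstant)) ^ 2))) atTop
      (𝓝 (3 * (δ A + 0
      + ENNReal.ofReal ((clampLimit f A - (entropy f - eulerConstant)) ^ 2)))) := by
    have h1 := ENNReal.tendsto_ofReal (hf.tendsto_integral_clamp_sub_sq hd hA
      (hf.ae_nearestDist_pos hd))
    rw [ENNReal.ofReal_zero] at h1
    exact ENNReal.Tendsto.const_mul ((tendsto_const_nhds.add h1).add tendsto_const_nhds)
      (Or.inr ENNReal.ofNat_ne_top)
  filter_upwards [hlimn.eventually_lt_const hAη, hrad, hσ] with n hn hradn hσn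
  refine (hf.lintegral_klEstimate_sub_sq_le hd n fun i => ?_).trans hn.le
  exact lintegral_sub_clamp_sq_le _ (measurable_logSpacing i) (fun s hs =>
    hf.sampleLaw_lt_abs_logSpacing_le hd hε hε1 hradn hσn i hs) hA

/-- Finite entropy and mean square consistency from a second logarithmic moment and a moment of
the local maximal function. -/
theorem IsProbDensity.l2Consistent (hd : 0 < d) (hf : IsProbDensity f)
    {Ω : Type*} [MeasurableSpace Ω] (P : Measure Ω) [IsProbabilityMeasure P] (X : ℕ → Ω → E d)
    (hX : ∀ i, Measurable (X i)) (hlaw : ∀ i, P.map (X i) = law f) (hindep : iIndepFun X P)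
    (hlog : HasLogSqMoment f) {ε R : ℝ} (hε : 0 < ε) (hR : 0 < R) (hQ : Q f ε R < ∞) :
    HasFiniteEntropy f ∧ L2Consistent P X f := by
  refine ⟨hf.hasFiniteEntropy hd hlog hε hR hQ, ?_⟩
  obtain ⟨ε', hε', hε1, hQ'⟩ := hf.exists_Q_lt_top_le_one hε hQ
  have h := hf.tendsto_lintegral_klEstimate_sub_sq hd hlog hε' hε1 hR hQ'
  unfold L2Consistent
  -- The limit ignores N = 0 and N = 1, where no neighbour exists.
  rw [← tendsto_add_atTop_iff_nat 2]
  refine h.congr fun n => ?_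
  have hmap : P.map (fun ω (i : Fin (n + 2)) => X i ω) = sampleLaw (law f) (n + 2) := by
    have hi : iIndepFun (fun i : Fin (n + 2) => X i) P := hindep.precomp Fin.val_injective
    rw [(iIndepFun_iff_map_fun_eq_pi_map fun i : Fin (n + 2) => (hX i).aemeasurable).1 hi]
    simp_rw [hlaw]
  rw [← hmap, lintegral_map ((measurable_klEstimate.sub_const _).pow_const 2).ennreal_ofReal
    (measurable_pi_lambda _ fun i => hX i)]

end KozachenkoLeonenko

end

theorem corollary3 {d : ℕ} (hd : 0 < d)
    {Ω : Type*} [MeasurableSpace Ω] (P : Measure Ω) [IsProbabilityMeasure P]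
    (X : ℕ → Ω → KozachenkoLeonenko.E d) (f : KozachenkoLeonenko.E d → ℝ)
    (hf : KozachenkoLeonenko.IsProbDensity f)
    (hX : ∀ i, Measurable (X i))
    (hlaw : ∀ i, P.map (X i) = volume.withDensity (fun x => ENNReal.ofReal (f x)))
    (hindep : iIndepFun X P) :
    (((∃ ε₀ : ℝ, 0 < ε₀ ∧ KozachenkoLeonenko.K₂ f ε₀ < ∞) ∨
          (∃ p : ℝ, 2 < p ∧ KozachenkoLeonenko.logMoment f p < ∞)) →
        ((∃ ε₁ R₁ : ℝ, 0 < ε₁ ∧ 0 < R₁ ∧ KozachenkoLeonenko.Q f ε₁ R₁ < ∞) ∨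
          KozachenkoLeonenko.CondB f) →
        ((∃ ε₂ R₂ : ℝ, 0 < ε₂ ∧ 0 < R₂ ∧ KozachenkoLeonenko.T f ε₂ R₂ < ∞) ∨
          KozachenkoLeonenko.CondC1 f) →
        KozachenkoLeonenko.HasFiniteEntropy f ∧ KozachenkoLeonenko.L2Consistent P X f) ∧
      (KozachenkoLeonenko.CondB f → KozachenkoLeonenko.CondC1 f →
        KozachenkoLeonenko.HasBoundedSupport f →
        KozachenkoLeonenko.HasFiniteEntropy f ∧ KozachenkoLeonenko.L2Consistent P X f) := by
  -- The lower bounds on the density (`T` and `C1`) are not needed: isolated sample points are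
  -- controlled by the packing bound and the logarithmic moment alone.
  refine ⟨fun h1 h2 _ => ?_, fun hB _ hbd => ?_⟩
  · have hlog : KozachenkoLeonenko.HasLogSqMoment f := by
      rcases h1 with ⟨ε, hε, h⟩ | ⟨p, hp, h⟩
      · exact hf.hasLogSqMoment_of_K₂ hε h
      · exact hf.hasLogSqMoment_of_logMoment hp h
    have hQ : ∃ ε R : ℝ, 0 < ε ∧ 0 < R ∧ KozachenkoLeonenko.Q f ε R < ∞ :=
      h2.elim id fun hB => hB.exists_Q_lt_top hd hf
    obtain ⟨ε, R, hε, hR, hQ⟩ := hQ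
    exact hf.l2Consistent hd P X hX hlaw hindep hlog hε hR hQ
  · obtain ⟨ε, R, hε, hR, hQ⟩ := hB.exists_Q_lt_top hd hf
    exact hf.l2Consistent hd P X hX hlaw hindep (hbd.hasLogSqMoment hf) hε hR hQ
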